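/- **Setting.** Let $q$ be a prime power and let $F$ be a global function field with full constant field $\mathbb F_q$ and at least one rational place; let $P_1,\dots,P_n$ ($n\ge 1$) be all rational places of $F$, let $t_i$ be a local parameter at $P_i$ for each $i$, and let $h$ be the class number of $F$. For a divisor $D$ let $v_P(D)$ be its coefficient at the place $P$, and let $\mathcal L(D)$ be its Riemann–Roch space. Fix an integer $m\ge 1$. For a positive (i.e. effective) divisor $D$ put $\overline D=\sum_{i=1}^n \min(m+1,v_{P_i}(D))\,P_i$, $\ j_l(D)=|\{i: v_{P_i}(D)=m-l\}|$ for $0\le l\le m$, and $J_m(D)=\sum_{l=1}^m (l+1)j_l(D)$. For nonnegative integers $X_1,\dots,X_m$ consider the condition $$(\ast)\qquad j_l(D)\le 2X_l+\sum_{\nu=l+1}^m X_\nu\ \ (1\le l\le m)\quad\text{and}\quad J_m(D)\le 2\sum_{l=1}^m (l+1)X_l .$$ For integers $r\ge s\ge 0$ let $\mathcal V_m(r,s;X_1,\dots,X_m)$ be the set of positive divisors $D$ with $\deg D=r$, $\deg\overline D\ge s$ and $(\ast)$. Call a divisor $G$ of degree $r$ *distinguished* (for $r,s,X_1,\dots,X_m$)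 if its support contains no $P_i$ and, for each nonzero $f\in\mathcal L(G)$ whose zero divisor $E=(f)_0$ satisfies $(\ast)$, one has $\deg\overline E\le s-1$. For $\boldsymbol\alpha=(\alpha_l^{(i)})_{1\le i\le n,\,1\le l\le m}\in\mathbb F_q^{mn}$ let $I_l(\boldsymbol\alpha)=\{i:\alpha^{(i)}_m=\cdots=\alpha^{(i)}_{l+1}=0,\ \alpha^{(i)}_l\ne 0\}$. For real numbers $x_1,\dots,x_m\ge 0$ with $x_1+\cdots+x_m\le 1$ and $\boldsymbol c\in\mathbb F_q^{mn}$ let $$M(x_1,\dots,x_m;\boldsymbol c)=\{\boldsymbol\alpha\in\mathbb F_q^{mn}: |I_l(\boldsymbol\alpha-\boldsymbol c)|\le\lfloor x_l n\rfloor\ (1\le l\le m)\}.$$ If the support of $G$ contains no $P_i$, then each $f\in\mathcal L(G)$ has a local expansion $f=\sum_{l\ge 0} f^{(l)}(P_i)\,t_i^l$ at $P_i$ with coefficients $f^{(l)}(P_i)\in\mathbb F_q$. Define $\mathbb F_q$-linear maps $\Phi:\mathcal L(G)\to\mathbb F_q^{mn}$ and $\psi:\mathcal L(G)\to\mathbb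 F_q^n$ by $\Phi(f)=\big(f^{(m-1)}(P_i),\dots,f^{(1)}(P_i),f^{(0)}(P_i)\big)_{1\le i\le n}$ and $\psi(f)=\big(f^{(m)}(P_1),\dots,f^{(m)}(P_n)\big)$, and put $N_{\boldsymbol c}=\{f\in\mathcal L(G):\Phi(f)\in M(x_1,\dots,x_m;\boldsymbol c)\}$. **Theorem.** Let $r\ge s\ge 0$ be integers and $x_1,\dots,x_m\ge 0$ real numbers with $x_1+\cdots+x_m\le 1$ such that $|\mathcal V_m(r,s;\lfloor x_1n\rfloor,\dots,\lfloor x_mn\rfloor)|<h$. Then there exists a distinguished divisor $G$ of degree $r$ for $r,s,\lfloor x_1n\rfloor,\dots,\lfloor x_mn\rfloor$. Let $G$ be any such divisor, and assume that $$|\mathcal L(G)|\cdot|M(x_1,\dots,x_m;\boldsymbol 0)|>q^{mn}.$$ Then there exists $\boldsymbol c\in\mathbb F_q^{mn}$ with $|N_{\boldsymbol c}|\ge |\mathcal L(G)|\cdot|M(x_1,\dots,x_m;\boldsymbol 0)|/q^{mn}$. If, in addition, $$(m+1)n\ge s+2\sum_{l=1}^m(l+1)\lfloor x_ln\rfloor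 ,$$ then for every such $\boldsymbol c$ the $q$-ary code $C=\psi(N_{\boldsymbol c})$ of length $n$ satisfies $$|C|\ge\left\lceil\frac{|\mathcal L(G)|\cdot|M(x_1,\dots,x_m;\boldsymbol 0)|}{q^{mn}}\right\rceil$$ and its minimum distance satisfies $$d(C)\ge (m+1)n+1-s-2\sum_{l=1}^m(l+1)\lfloor x_ln\rfloor .$$ -/

import Mathlib

open scoped WithZero

namespace GlobalFF

universe u v

/-- `F` is an algebraic function field of one variable over `k` (that is, a finite extension of
`k(x)` for some `x ∈ F` transcendental over `k`) whose full constant field is `k`.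
For finite `k` these are the global function fields with full constant field `k`. -/
structure IsFunctionFieldWithFullConstants (k : Type u) (F : Type v) [Field k] [Field F]
    [Algebra k F] : Prop where
  exists_finite : ∃ x : F, Transcendental k x ∧
    FiniteDimensional (IntermediateField.adjoin k ({x} : Set F)) F
  full_constants : ∀ z : F, IsAlgebraic k z → z ∈ Set.range (algebraMap k F)

/-- A place of `F/k`, given by its normalized discrete valuation: a surjective valuation
`F → ℤᵐ⁰` (written multiplicatively, so `val f = exp (- v_P f)`) which is trivial on `k`. -/
@[ext]
structure Place (k : Type u) (F : Type v) [Field k] [Field F] [Algebra k F] where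
  val : Valuation F ℤᵐ⁰
  surjective_val : Function.Surjective val
  val_algebraMap : ∀ a : k, a ≠ 0 → val (algebraMap k F a) = 1

variable {k : Type u} {F : Type v} [Field k] [Field F] [Algebra k F]

namespace Place

lemma val_algebraMap_le (Q : Place k F) (a : k) : Q.val (algebraMap k F a) ≤ 1 := by
  by_cases h : a = 0
  · simp [h]
  · exact (Q.val_algebraMap a h).le

/-- The normalized discrete valuation `v_Q(f) ∈ ℤ` of `f ≠ 0`, written additively.
(At `f = 0` it has the meaningless value `0`; it is only used for `f ≠ 0`.) -/
noncomputable def ord (Q : Place k F) (f : F) : ℤ := -(WithZero.log (Q.val f))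

/-- The valuation ring of the place. -/
def integers (Q : Place k F) : ValuationSubring F := Q.val.valuationSubring

/-- The valuation ring of a place is a `k`-algebra. -/
instance instAlgebraIntegers (Q : Place k F) : Algebra k Q.integers :=
  RingHom.toAlgebra ((algebraMap k F).codRestrict Q.integers (fun a => Q.val_algebraMap_le a))

/-- The degree of a place: the degree over `k` of its residue class field. -/
noncomputable def degree (Q : Place k F) : ℕ :=
  Module.finrank k (IsLocalRing.ResidueField Q.integers)

/-- A rational place is a place of degree one. -/
def IsRational (Q : Place k F) : Prop := Q.degree = 1

/-- `t` is a local parameter at `Q`, i.e. `v_Q(t) = 1`. -/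
def IsLocalParameter (Q : Place k F) (t : F) : Prop := t ≠ 0 ∧ Q.ord t = 1

/-- `f = ∑_{l ≥ 0} a_l t^l` in the completion of `F` at `Q`, with coefficients `a_l ∈ k`:
`v_Q (f - ∑_{l < N} a_l t^l) ≥ N` for all `N`. -/
def IsLocalExpansion (Q : Place k F) (t f : F) (a : ℕ → k) : Prop :=
  ∀ N : ℕ, Q.val (f - ∑ l ∈ Finset.range N, algebraMap k F (a l) * t ^ l)
    ≤ WithZero.exp (-(N : ℤ))

open Classical in
/-- The coefficient `f^{(l)}(Q) ∈ k` of the local expansion of `f` at `Q` with respect to `t`.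
For a rational place `Q`, a local parameter `t` at `Q` and `f` with `v_Q(f) ≥ 0` the expansion
exists and is unique (see `existsUnique_isLocalExpansion`); otherwise the value is irrelevant. -/
noncomputable def localCoeff (Q : Place k F) (t f : F) : ℕ → k :=
  if h : ∃ a : ℕ → k, Q.IsLocalExpansion t f a then Classical.choose h else 0

lemma val_of_isLocalParameter {Q : Place k F} {t : F} (ht : Q.IsLocalParameter t) :
    Q.val t = WithZero.exp (-1 : ℤ) := by
  have h0 : Q.val t ≠ 0 := (Valuation.ne_zero_iff _).2 ht.1
  have h1 : WithZero.log (Q.val t) = -1 := by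
    have := ht.2
    unfold ord at this
    omega
  rw [← WithZero.exp_log h0, h1]

lemma exists_residue {Q : Place k F} (hQ : Q.IsRational) (f : F) (hf : Q.val f ≤ 1) :
    ∃ a : k, Q.val (f - algebraMap k F a) ≤ WithZero.exp (-1 : ℤ) := by
  have h1 : Module.finrank k (IsLocalRing.ResidueField Q.integers) = 1 := hQ
  have h2 := (finrank_eq_one_iff_of_nonzero' (1 : IsLocalRing.ResidueField Q.integers)
    one_ne_zero).1 h1
  let g : Q.integers := ⟨f, hf⟩
  obtain ⟨a, ha⟩ := h2 (IsLocalRing.residue _ g)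
  refine ⟨a, ?_⟩
  have h3 : IsLocalRing.residue Q.integers (g - algebraMap k Q.integers a) = 0 := by
    rw [map_sub, ← ha, Algebra.smul_def, mul_one, sub_eq_zero]
    rfl
  rw [IsLocalRing.residue_eq_zero_iff] at h3
  have h4 : Q.val (f - algebraMap k F a) < 1 := by
    have := (Q.integers.valuation_lt_one_iff _).1 h3
    exact (Valuation.isEquiv_iff_val_lt_one.1
      (Valuation.isEquiv_valuation_valuationSubring Q.val)).2 this
  by_cases h5 : Q.val (f - algebraMap k F a) = 0
  · rw [h5]; exact zero_le
  · rw [← WithZero.log_le_iff_le_exp h5]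
    have : WithZero.log (Q.val (f - algebraMap k F a)) < 0 := by
      rw [WithZero.log_lt_iff_lt_exp h5]; simpa using h4
    omega

theorem existsUnique_isLocalExpansion {Q : Place k F} (hQ : Q.IsRational) {t : F}
    (ht : Q.IsLocalParameter t) (f : F) (hf : Q.val f ≤ 1) :
    ∃! a : ℕ → k, Q.IsLocalExpansion t f a := by
  have hvt := val_of_isLocalParameter ht
  have hpow : ∀ N : ℕ, Q.val (t ^ N) = WithZero.exp (-(N : ℤ)) := by
    intro N
    rw [map_pow, hvt, ← WithZero.exp_nsmul]
    simp
  have step : ∀ g : {g : F // Q.val g ≤ 1}, ∃ a : k, Q.val ((g.1 - algebraMap k F a) / t) ≤ 1 := by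
    intro g
    obtain ⟨a, ha⟩ := exists_residue hQ g.1 g.2
    refine ⟨a, ?_⟩
    rw [map_div₀, hvt]
    exact div_le_one_of_le₀ ha zero_le
  choose r hr using step
  let s : ℕ → {g : F // Q.val g ≤ 1} := fun N =>
    Nat.rec ⟨f, hf⟩ (fun _ g => ⟨(g.1 - algebraMap k F (r g)) / t, hr g⟩) N
  have hs : ∀ N : ℕ, f - ∑ l ∈ Finset.range N, algebraMap k F (r (s l)) * t ^ l
      = t ^ N * (s N).1 := by
    intro N
    induction N with
    | zero => simp [s]
    | succ N ih =>
      have : (s (N + 1)).1 = ((s N).1 - algebraMap k F (r (s N))) / t := rfl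
      rw [Finset.sum_range_succ, ← sub_sub, ih, this]
      have := ht.1
      field_simp
      ring
  refine ⟨fun l => r (s l), ?_, ?_⟩
  · intro N
    rw [hs N, map_mul, hpow]
    exact mul_le_of_le_one_right' (s N).2
  · intro b hb
    have ha : Q.IsLocalExpansion t f (fun l => r (s l)) := by
      intro N
      rw [hs N, map_mul, hpow]
      exact mul_le_of_le_one_right' (s N).2
    funext l
    induction l using Nat.strong_induction_on with
    | _ l ih =>
      by_contra hne
      have hsum : ∑ i ∈ Finset.range l, algebraMap k F (b i) * t ^ i
          = ∑ i ∈ Finset.range l, algebraMap k F (r (s i)) * t ^ i :=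
        Finset.sum_congr rfl (fun i hi => by rw [ih i (Finset.mem_range.1 hi)])
      have h1 := ha (l + 1)
      have h2 := hb (l + 1)
      have h3 := (Q.val.map_sub_le h1 h2)
      rw [Finset.sum_range_succ, Finset.sum_range_succ, hsum] at h3
      have h4 : algebraMap k F (b l - r (s l)) * t ^ l =
          (f - (∑ i ∈ Finset.range l, algebraMap k F (r (s i)) * t ^ i
            + algebraMap k F (r (s l)) * t ^ l)) -
          (f - (∑ i ∈ Finset.range l, algebraMap k F (r (s i)) * t ^ i
            + algebraMap k F (b l) * t ^ l)) := by
        rw [map_sub]; ring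
      rw [← h4, map_mul, Q.val_algebraMap _ (sub_ne_zero.2 hne), hpow, one_mul,
        WithZero.exp_le_exp] at h3
      push_cast at h3
      omega

end Place

/-- Divisors of `F`: finite formal `ℤ`-linear combinations of places. The coefficient `v_Q(D)`
is `D Q`, and a positive divisor is a divisor `D` with `0 ≤ D`. -/
abbrev Divisor (k : Type u) (F : Type v) [Field k] [Field F] [Algebra k F] := Place k F →₀ ℤ

namespace Divisor

/-- The degree `∑_Q v_Q(D) deg(Q)`, as a homomorphism to `ℤ`. -/
noncomputable def degree : Divisor k F →+ ℤ :=
  (Finsupp.linearCombination ℤ (fun Q : Place k F => (Q.degree : ℤ))).toAddMonoidHom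

/-- The group of principal divisors `(f) = ∑_Q v_Q(f) Q`, `f ≠ 0`. -/
def principal : AddSubgroup (Divisor k F) where
  carrier := {D | ∃ f : F, f ≠ 0 ∧ ∀ Q, D Q = Q.ord f}
  zero_mem' := ⟨1, one_ne_zero, fun Q => by simp [Place.ord]⟩
  add_mem' := by
    rintro D E ⟨f, hf, hD⟩ ⟨g, hg, hE⟩
    refine ⟨f * g, mul_ne_zero hf hg, fun Q => ?_⟩
    rw [Finsupp.add_apply, hD, hE, Place.ord, Place.ord, Place.ord, map_mul,
      WithZero.log_mul ((Valuation.ne_zero_iff _).2 hf) ((Valuation.ne_zero_iff _).2 hg)]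
    ring
  neg_mem' := by
    rintro D ⟨f, hf, hD⟩
    refine ⟨f⁻¹, inv_ne_zero hf, fun Q => ?_⟩
    rw [Finsupp.neg_apply, hD, Place.ord, Place.ord, map_inv₀, WithZero.log_inv]

/-- The group of divisors of degree zero. -/
noncomputable def degreeZero : AddSubgroup (Divisor k F) := (degree (k := k) (F := F)).ker

end Divisor

/-- The class number of `F`: the order of the group of divisor classes of degree zero. -/
noncomputable def classNumber (k : Type u) (F : Type v) [Field k] [Field F] [Algebra k F] : ℕ :=
  Nat.card ((Divisor.degreeZero (k := k) (F := F)) ⧸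
    (Divisor.principal (k := k) (F := F)).addSubgroupOf Divisor.degreeZero)

/-- The Riemann-Roch space `L(G) = {f ∈ F : v_Q(f) ≥ -v_Q(G) for all places Q}`;
in multiplicative notation `v_Q(f) ≥ -v_Q(G)` reads `Q.val f ≤ exp (v_Q(G))`. -/
def riemannRochSpace (G : Divisor k F) : Submodule k F where
  carrier := {f | ∀ Q : Place k F, Q.val f ≤ WithZero.exp (G Q)}
  zero_mem' := fun Q => by simp
  add_mem' := fun hf hg Q => Q.val.map_add_le (hf Q) (hg Q)
  smul_mem' := fun a f hf Q => by
    rw [Algebra.smul_def, map_mul]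
    exact (mul_le_of_le_one_left' (Q.val_algebraMap_le a)).trans (hf Q)

/-- The family of coefficients `v_Q((f)_0) = max(v_Q(f), 0)` of the zero divisor `(f)_0` of
`f ≠ 0`. -/
noncomputable def zeroOrders (f : F) : Place k F → ℤ := fun Q => max (Q.ord f) 0

/-! In the following definitions `P 0, …, P (n-1)` stand for the rational places
`P_1, …, P_n`, and `E` is the family of coefficients of a positive divisor. Families indexed by
`1, …, m` are indexed by `Fin m`, where `l : Fin m` stands for the index `l + 1`. -/

variable {n m : ℕ}

/-- The divisor `a_1 P_1 + ⋯ + a_n P_n` with `a_i = min(m + 1, v_{P_i}(E))`. -/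
noncomputable def restrictDivisor (P : Fin n → Place k F) (m : ℕ) (E : Place k F → ℤ) :
    Divisor k F :=
  ∑ i, Finsupp.single (P i) (min ((m : ℤ) + 1) (E (P i)))

/-- `j_l(E) = |{i : v_{P_i}(E) = m - l}|`, for `0 ≤ l ≤ m`. -/
noncomputable def jCount (P : Fin n → Place k F) (m : ℕ) (E : Place k F → ℤ) (l : ℕ) : ℕ :=
  (Finset.univ.filter (fun i : Fin n => E (P i) = (m : ℤ) - (l : ℤ))).card

/-- `J_m(E) = 2 j_1(E) + 3 j_2(E) + ⋯ + (m+1) j_m(E)`. -/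
noncomputable def jSum (P : Fin n → Place k F) (m : ℕ) (E : Place k F → ℤ) : ℕ :=
  ∑ l : Fin m, ((l : ℕ) + 2) * jCount P m E ((l : ℕ) + 1)

/-- `j_l(E) ≤ 2 X_l + (X_{l+1} + ⋯ + X_m)` for all `1 ≤ l ≤ m`. -/
def CountBound (P : Fin n → Place k F) (X : Fin m → ℕ) (E : Place k F → ℤ) : Prop :=
  ∀ l : Fin m, jCount P m E ((l : ℕ) + 1) ≤ 2 * X l + ∑ ν ∈ Finset.Ioi l, X ν

/-- `J_m(E) ≤ 2 (2 X_1 + 3 X_2 + ⋯ + (m+1) X_m)`. -/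
def SumBound (P : Fin n → Place k F) (X : Fin m → ℕ) (E : Place k F → ℤ) : Prop :=
  jSum P m E ≤ 2 * ∑ l : Fin m, ((l : ℕ) + 2) * X l

/-- The set `V_m(r, s; X_1, …, X_m)` of positive divisors. -/
def divisorSet (P : Fin n → Place k F) (r s : ℕ) (X : Fin m → ℕ) : Set (Divisor k F) :=
  {D | 0 ≤ D ∧ Divisor.degree D = r ∧ (s : ℤ) ≤ Divisor.degree (restrictDivisor P m D) ∧
    CountBound P X D ∧ SumBound P X D}

/-- `G` is a distinguished divisor of degree `r`: its support contains none of the `P_i`, and for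
each nonzero `f ∈ L(G)` whose zero divisor `E = (f)_0` satisfies the bounds on `j_l(E)` and
`J_m(E)`, the restricted divisor of `E` has degree at most `s - 1`. -/
def IsDistinguished (P : Fin n → Place k F) (r s : ℕ) (X : Fin m → ℕ) (G : Divisor k F) : Prop :=
  Divisor.degree G = r ∧ (∀ i, G (P i) = 0) ∧
  ∀ f ∈ riemannRochSpace G, f ≠ 0 →
    CountBound P X (zeroOrders (k := k) f) → SumBound P X (zeroOrders (k := k) f) →
    Divisor.degree (restrictDivisor P m (zeroOrders (k := k) f)) ≤ (s : ℤ) - 1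

open Classical in
/-- For `α ∈ k^{mn}` with coordinates `α_l^{(i)}`, the set
`I_l(α) = {i : α_m^{(i)} = ⋯ = α_{l+1}^{(i)} = 0, α_l^{(i)} ≠ 0}`. -/
noncomputable def lastNonzero (α : Fin n → Fin m → k) (l : Fin m) : Finset (Fin n) :=
  Finset.univ.filter (fun i => (∀ l', l < l' → α i l' = 0) ∧ α i l ≠ 0)

/-- `M(x_1, …, x_m; c) = {α ∈ k^{mn} : |I_l(α - c)| ≤ ⌊x_l n⌋ for 1 ≤ l ≤ m}`. -/
def ballSet (x : Fin m → ℝ) (c : Fin n → Fin m → k) : Set (Fin n → Fin m → k) :=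
  {α | ∀ l, (lastNonzero (α - c) l).card ≤ ⌊x l * n⌋₊}

/-- `Φ(f) = (φ_1(f), …, φ_n(f))` with
`φ_i(f) = (f^{(m-1)}(P_i), …, f^{(1)}(P_i), f^{(0)}(P_i))`. -/
noncomputable def lowCoeffs (P : Fin n → Place k F) (t : Fin n → F) (m : ℕ) (f : F) :
    Fin n → Fin m → k :=
  fun i l => (P i).localCoeff (t i) f (m - 1 - (l : ℕ))

/-- `ψ(f) = (f^{(m)}(P_1), …, f^{(m)}(P_n))`. -/
noncomputable def topCoeffs (P : Fin n → Place k F) (t : Fin n → F) (m : ℕ) (f : F) : Fin n → k :=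
  fun i => (P i).localCoeff (t i) f m

/-- `N_c = {f ∈ L(G) : Φ(f) ∈ M(x_1, …, x_m; c)}`. -/
def fiberSet (P : Fin n → Place k F) (t : Fin n → F) (x : Fin m → ℝ) (G : Divisor k F)
    (c : Fin n → Fin m → k) : Set F :=
  {f | f ∈ riemannRochSpace G ∧ lowCoeffs P t m f ∈ ballSet x c}

open Classical in
/-- The minimum distance of a code `C ⊆ k^n` with at least two codewords: the least Hamming
distance between distinct codewords. -/
noncomputable def minDistance (C : Set (Fin n → k)) : ℕ :=
  sInf {d | ∃ u ∈ C, ∃ w ∈ C, u ≠ w ∧ hammingDist u w = d}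

end GlobalFF

/-!
The existence of a distinguished divisor is a count of divisor classes. Since `V_m(r, s; X)` has
fewer than `h` elements, some divisor class of degree `r` contains none of them, and by weak
approximation (`exists_ord_eq_neg`) it contains a divisor `G` whose support avoids all `P_i`. For
`0 ≠ f ∈ L(G)` the effective divisor `G + (f)` lies in that class and agrees with `(f)_0` at every
`P_i`, so if `(f)_0` satisfies the bounds on `j_l` and `J_m`, the degree of its restriction to the
`P_i` is at most `s - 1`. This uses that nonzero functions have divisors and that these have degree
zero (`IsFunctionFieldWithFullConstants.degree_eq_zero`), which is proved here from scratch: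

* for `f` transcendental and a `k`-subspace `M` of `F` with `f M ⊆ M`,
  `dim_k (M / f M) ≤ [F : k(f)]` (`relLength_mul_le`). Applied to the functions integral
  at a finite set of zeros of `f`, where
  weak approximation computes the dimension, this bounds the degree of the zero divisor by
  `[F : k(f)]`;
* the same inequality shows that all `k`-subalgebras of `F` are Noetherian, so valuation rings of
  `F` over `k` are discrete and every nonconstant function has a pole. Hence
  `dim L(e) ≤ 1 + deg e` for `e ≥ 0`, and letting `r` grow in the independent family `f^i u_j`,
  `i ≤ r`, with `u_j` a basis of `F` over `k(f)`, bounds the degree of the pole divisor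
  below by `[F : k(f)]`.

Comparing the two bounds for `f` and for `f⁻¹` gives degree zero.

The vector `c` exists by averaging (`exists_translate_card_ge`). For the distance, let `f ≠ g` be
in `N_c` and let `E` be the zero divisor of `f - g`. The number `j_l(E)` is the number of `i` such
that the `l`-th coordinate is the last nonzero one of the `i`-th block of
`(Φ(f) - c) - (Φ(g) - c)`, a difference of two elements of `M(x; 0)`, whence the
bounds on `j_l(E)` and `J_m(E)`. As `G` is distinguished, the restricted divisor `Ē` has degree at most
`s - 1`, while `deg Ē + J_m(E) + j_0(E) = (m + 1) n` and `ψ(f)`, `ψ(g)` differ in at least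
`j_0(E)` positions. The resulting bound is positive, so `ψ` is injective on `N_c` and `|C| = |N_c|`.
-/

namespace GlobalFF

universe u v

variable {k : Type u} {F : Type v} [Field k] [Field F] [Algebra k F]

/-! ### Valuations of places and weak approximation -/

namespace Place

lemma val_eq_exp_neg_ord (Q : Place k F) {f : F} (hf : f ≠ 0) :
    Q.val f = WithZero.exp (-Q.ord f) := by
  rw [ord, neg_neg, WithZero.exp_log ((Valuation.ne_zero_iff _).2 hf)]

lemma val_le_exp_iff (Q : Place k F) {f : F} (hf : f ≠ 0) (a : ℤ) :
    Q.val f ≤ WithZero.exp a ↔ -a ≤ Q.ord f := by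
  rw [val_eq_exp_neg_ord Q hf, WithZero.exp_le_exp, neg_le]

lemma ord_eq_of_val_eq (Q : Place k F) {f : F} {a : ℤ} (h : Q.val f = WithZero.exp a) :
    Q.ord f = -a := by
  rw [ord, h, WithZero.log_exp]

lemma ord_inv (Q : Place k F) (f : F) : Q.ord f⁻¹ = -Q.ord f := by
  rw [ord, ord, map_inv₀, WithZero.log_inv]

lemma ord_algebraMap (Q : Place k F) {a : k} (ha : a ≠ 0) : Q.ord (algebraMap k F a) = 0 := by
  rw [ord, Q.val_algebraMap a ha, WithZero.log_one, neg_zero]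

lemma exists_val_eq_exp (Q : Place k F) (a : ℤ) : ∃ u : F, u ≠ 0 ∧ Q.val u = WithZero.exp a := by
  obtain ⟨u, hu⟩ := Q.surjective_val (WithZero.exp a)
  exact ⟨u, (Valuation.ne_zero_iff Q.val).1 (by rw [hu]; exact WithZero.exp_ne_zero), hu⟩

/-- The real absolute value `2 ^ (-v_Q(f))` attached to a place `Q`. -/
noncomputable def absoluteValue (Q : Place k F) : AbsoluteValue F ℝ where
  toFun f := (WithZeroMulInt.toNNReal (two_ne_zero (α := NNReal)) (Q.val f) : ℝ)
  map_mul' f g := by simp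
  nonneg' f := NNReal.coe_nonneg _
  eq_zero' f := by simp
  add_le' f g := by
    have hmono := (WithZeroMulInt.toNNReal_strictMono (e := 2) one_lt_two).monotone
    rcases le_total (Q.val f) (Q.val g) with h | h
    · have h1 : Q.val (f + g) ≤ Q.val g := Q.val.map_add_le h le_rfl
      exact (NNReal.coe_le_coe.2 (hmono h1)).trans (le_add_of_nonneg_left (NNReal.coe_nonneg _))
    · have h1 : Q.val (f + g) ≤ Q.val f := Q.val.map_add_le le_rfl h
      exact (NNReal.coe_le_coe.2 (hmono h1)).trans (le_add_of_nonneg_right (NNReal.coe_nonneg _))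

lemma absoluteValue_le_iff (Q : Place k F) (f g : F) :
    Q.absoluteValue f ≤ Q.absoluteValue g ↔ Q.val f ≤ Q.val g := by
  change ((_ : NNReal) : ℝ) ≤ ((_ : NNReal) : ℝ) ↔ _
  rw [NNReal.coe_le_coe]
  exact (WithZeroMulInt.toNNReal_strictMono (e := 2) one_lt_two).le_iff_le

lemma absoluteValue_isNontrivial (Q : Place k F) : Q.absoluteValue.IsNontrivial := by
  obtain ⟨u, hu, hv⟩ := Q.exists_val_eq_exp 1
  refine ⟨u, hu, fun h => ?_⟩
  have h1 : Q.absoluteValue u ≤ Q.absoluteValue 1 := by rw [h, map_one]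
  rw [absoluteValue_le_iff, hv, map_one, ← WithZero.exp_zero, WithZero.exp_le_exp] at h1
  omega

lemma eq_of_absoluteValue_isEquiv {P Q : Place k F}
    (h : P.absoluteValue.IsEquiv Q.absoluteValue) : P = Q := by
  have hle : ∀ f g : F, P.val f ≤ P.val g ↔ Q.val f ≤ Q.val g := fun f g => by
    rw [← absoluteValue_le_iff, ← absoluteValue_le_iff]; exact h f g
  have heq : ∀ f g : F, P.val f = P.val g ↔ Q.val f = Q.val g := fun f g => by
    rw [le_antisymm_iff, le_antisymm_iff, hle, hle]
  obtain ⟨u, hu, hQu⟩ := Q.exists_val_eq_exp 1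
  obtain ⟨e, hPu⟩ : ∃ e : ℤ, P.val u = WithZero.exp e := ⟨_, P.val_eq_exp_neg_ord hu⟩
  have key : ∀ (f : F) (a : ℤ), Q.val f = WithZero.exp a → P.val f = WithZero.exp (a * e) := by
    intro f a hf
    have h1 : P.val f = P.val (u ^ a) := by
      rw [heq, hf, map_zpow₀, hQu, ← WithZero.exp_zsmul, smul_eq_mul, mul_one]
    rw [h1, map_zpow₀, hPu, ← WithZero.exp_zsmul, smul_eq_mul]
  -- some element has `P`-valuation `exp 1`, so `e` is a unit; it is positive by monotonicity
  have he : e = 1 := by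
    obtain ⟨w, hw, hPw⟩ := P.exists_val_eq_exp 1
    have h1 := key w _ (Q.val_eq_exp_neg_ord hw)
    rw [hPw, WithZero.exp_inj] at h1
    have h2 : ¬ P.val u ≤ P.val 1 := by
      rw [hle, hQu, map_one, ← WithZero.exp_zero, WithZero.exp_le_exp]; omega
    rw [hPu, map_one, ← WithZero.exp_zero, WithZero.exp_le_exp] at h2
    rcases Int.eq_one_or_neg_one_of_mul_eq_one' h1.symm with h3 | h3 <;> omega
  ext f
  by_cases hf : f = 0
  · simp [hf]
  · rw [key f _ (Q.val_eq_exp_neg_ord hf), he, mul_one, Q.val_eq_exp_neg_ord hf]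

/-- Weak approximation for finitely many distinct places. -/
theorem exists_val_sub_le (S : Finset (Place k F)) (a : Place k F → F) (N : Place k F → ℤ) :
    ∃ z : F, ∀ Q ∈ S, Q.val (z - a Q) ≤ WithZero.exp (N Q) := by
  have hdense := AbsoluteValue.denseRange_algebraMap_pi
    (v := fun Q : S => Q.1.absoluteValue) (fun Q => Q.1.absoluteValue_isNontrivial)
    (fun P Q hPQ h => hPQ (Subtype.ext (eq_of_absoluteValue_isEquiv h)))
  choose u hu huN using fun Q : Place k F => Q.exists_val_eq_exp (N Q)
  let c : (Q : S) → WithAbs Q.1.absoluteValue := fun Q => WithAbs.toAbs _ (a Q.1)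
  have hopen : IsOpen (Set.pi Set.univ
      (fun Q : S => Metric.ball (c Q) (Q.1.absoluteValue (u Q.1)))) :=
    isOpen_set_pi Set.finite_univ (fun _ _ => Metric.isOpen_ball)
  obtain ⟨z, hz⟩ := hdense.exists_mem_open hopen
    ⟨c, fun Q _ => Metric.mem_ball_self (Q.1.absoluteValue.pos (hu Q.1))⟩
  refine ⟨z, fun Q hQ => ?_⟩
  have h1 := hz ⟨Q, hQ⟩ (Set.mem_univ _)
  rw [Metric.mem_ball, dist_eq_norm] at h1
  have h2 : Q.absoluteValue (z - a Q) < Q.absoluteValue (u Q) := by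
    rwa [WithAbs.norm_eq_apply_ofAbs] at h1
  rw [← huN]
  exact (absoluteValue_le_iff _ _ _).1 h2.le

end Place

/-! ### Relative lengths of spaces of functions with prescribed poles -/

/-- The dimension over `k` of `B / (A ∩ B)` for subspaces `A`, `B` of `F`. It is an extended natural
number, so additivity along chains holds without finiteness assumptions. -/
noncomputable def relLength (A B : Submodule k F) : ℕ∞ := Module.length k (B ⧸ A.submoduleOf B)

lemma relLength_add {A B C : Submodule k F} (hAB : A ≤ B) (hBC : B ≤ C) :
    relLength A C = relLength A B + relLength B C := by
  let f : (B ⧸ A.submoduleOf B) →ₗ[k] (C ⧸ A.submoduleOf C) :=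
    Submodule.mapQ _ _ (Submodule.inclusion hBC) (fun x hx => hx)
  let g : (C ⧸ A.submoduleOf C) →ₗ[k] (C ⧸ B.submoduleOf C) :=
    Submodule.mapQ _ _ LinearMap.id (fun x hx => hAB hx)
  refine Module.length_eq_add_of_exact f g ?_ ?_ ?_
  · rw [injective_iff_map_eq_zero]
    intro x hx
    obtain ⟨x, rfl⟩ := Submodule.mkQ_surjective _ x
    exact (Submodule.Quotient.mk_eq_zero _).2
      ((Submodule.Quotient.mk_eq_zero (A.submoduleOf C) (x := Submodule.inclusion hBC x)).1 hx)
  · intro x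
    obtain ⟨x, rfl⟩ := Submodule.mkQ_surjective _ x
    exact ⟨Submodule.mkQ _ x, rfl⟩
  · intro x
    obtain ⟨x, rfl⟩ := Submodule.mkQ_surjective _ x
    constructor
    · intro hx
      exact ⟨Submodule.mkQ _ ⟨x.1,
        (Submodule.Quotient.mk_eq_zero (B.submoduleOf C) (x := x)).1 hx⟩, rfl⟩
    · rintro ⟨y, hy⟩
      obtain ⟨y, rfl⟩ := Submodule.mkQ_surjective _ y
      rw [← hy]
      exact (Submodule.Quotient.mk_eq_zero _).2 y.2

lemma relLength_self (A : Submodule k F) : relLength A A = 0 := by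
  rw [relLength, Module.length_eq_zero_iff, Submodule.Quotient.subsingleton_iff]
  exact Submodule.submoduleOf_self A

lemma relLength_bot (A : Submodule k F) : relLength ⊥ A = Module.length k A := by
  have : (⊥ : Submodule k F).submoduleOf A = ⊥ := by
    simp [Submodule.submoduleOf]
  rw [relLength, this]
  exact (Submodule.quotEquivOfEqBot _ rfl).length_eq

/-- The `k`-space of all `f ∈ F` with `v_Q(f) ≥ -D(Q)` for all `Q ∈ S`. -/
def boundedSpace (S : Set (Place k F)) (D : Place k F → ℤ) : Submodule k F where
  carrier := {f | ∀ Q ∈ S, Q.val f ≤ WithZero.exp (D Q)}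
  zero_mem' := fun Q _ => by simp
  add_mem' := fun hf hg Q hQ => Q.val.map_add_le (hf Q hQ) (hg Q hQ)
  smul_mem' := fun a f hf Q hQ => by
    rw [Algebra.smul_def, map_mul]
    exact (mul_le_of_le_one_left' (Q.val_algebraMap_le a)).trans (hf Q hQ)

lemma boundedSpace_mono (S : Set (Place k F)) {D D' : Place k F → ℤ} (h : D ≤ D') :
    boundedSpace S D ≤ boundedSpace S D' :=
  fun _ hf Q hQ => (hf Q hQ).trans (WithZero.exp_le_exp.2 (h Q))

/-- For `P ∈ S` and `v_P(u) = D(P) + 1`, the map `z ↦ (z u)(P)` from the space of functions with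
poles bounded by `D + P` to the residue field of `P`; its kernel is the space for `D`. -/
noncomputable def leadingCoeffMap (S : Set (Place k F)) (D : Place k F → ℤ) (P : Place k F)
    (hP : P ∈ S) (u : F) (hu : P.val u = WithZero.exp (-(D P + 1))) :
    boundedSpace S (D + ⇑(Finsupp.single P (1 : ℤ))) →ₗ[k] IsLocalRing.ResidueField P.integers where
  toFun z := IsLocalRing.residue P.integers ⟨z.1 * u, by
    change P.val _ ≤ 1
    have h := z.2 P hP
    rw [Pi.add_apply, Finsupp.single_eq_same] at h
    rw [map_mul, hu]
    calc _ ≤ WithZero.exp (D P + 1) * WithZero.exp (-(D P + 1)) := by gcongr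
      _ = 1 := by rw [← WithZero.exp_add, add_neg_cancel, WithZero.exp_zero]⟩
  map_add' z w := by
    rw [← map_add]
    congr 1
    exact Subtype.ext (add_mul _ _ _)
  map_smul' a z := by
    rw [RingHom.id_apply, Algebra.smul_def]
    change _ = IsLocalRing.residue P.integers (algebraMap k P.integers a) * _
    refine Eq.trans (congrArg _ (Subtype.ext ?_)) (map_mul (IsLocalRing.residue P.integers) _ _)
    change (a • z.1) * u = algebraMap k F a * (z.1 * u)
    rw [Algebra.smul_def, mul_assoc]

lemma residue_eq_zero_iff_val (P : Place k F) (g : P.integers) :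
    IsLocalRing.residue P.integers g = 0 ↔ P.val g.1 < 1 := by
  rw [IsLocalRing.residue_eq_zero_iff]
  refine (P.integers.valuation_lt_one_iff g).trans ?_
  exact (Valuation.isEquiv_iff_val_lt_one.1
    (Valuation.isEquiv_valuation_valuationSubring P.val)).symm

lemma lt_exp_add_one_iff {x : ℤᵐ⁰} {a : ℤ} :
    x < WithZero.exp (a + 1) ↔ x ≤ WithZero.exp a := by
  by_cases h : x = 0
  · simp [h]
  · rw [← WithZero.exp_log h, WithZero.exp_lt_exp, WithZero.exp_le_exp]
    omega

lemma ker_leadingCoeffMap (S : Set (Place k F)) (D : Place k F → ℤ) (P : Place k F)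
    (hP : P ∈ S) (u : F) (hu : P.val u = WithZero.exp (-(D P + 1))) :
    LinearMap.ker (leadingCoeffMap S D P hP u hu) =
      (boundedSpace S D).submoduleOf (boundedSpace S (D + ⇑(Finsupp.single P (1 : ℤ)))) := by
  ext z
  rw [LinearMap.mem_ker]
  refine (residue_eq_zero_iff_val P _).trans ?_
  change P.val (z.1 * u) < 1 ↔ z.1 ∈ boundedSpace S D
  have h1 : P.val (z.1 * u) < 1 ↔ P.val z.1 ≤ WithZero.exp (D P) := by
    rw [map_mul, hu, ← lt_exp_add_one_iff, WithZero.exp_neg, ← div_eq_mul_inv,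
      div_lt_one₀ (by simp)]
  rw [h1]
  constructor
  · intro h Q hQ
    by_cases hQP : Q = P
    · rw [hQP]; exact h
    · have := z.2 Q hQ
      rwa [Pi.add_apply, Finsupp.single_eq_of_ne hQP, add_zero] at this
  · exact fun h => h P hP

lemma relLength_boundedSpace_single_le (S : Set (Place k F)) (D : Place k F → ℤ) (P : Place k F)
    (hP : P ∈ S) :
    relLength (boundedSpace S D) (boundedSpace S (D + ⇑(Finsupp.single P (1 : ℤ)))) ≤
      Module.length k (IsLocalRing.ResidueField P.integers) := by
  obtain ⟨u, -, hu⟩ := P.exists_val_eq_exp (-(D P + 1))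
  rw [relLength, ← ker_leadingCoeffMap S D P hP u hu,
    (LinearMap.quotKerEquivRange _).length_eq]
  exact Module.length_le_of_injective _ (Submodule.subtype_injective _)

/-- For finite `S`, weak approximation makes `leadingCoeffMap` surjective. -/
lemma le_relLength_boundedSpace_single (S : Finset (Place k F)) (D : Place k F → ℤ)
    (P : Place k F) (hP : P ∈ S) :
    Module.length k (IsLocalRing.ResidueField P.integers) ≤
      relLength (boundedSpace ↑S D) (boundedSpace ↑S (D + ⇑(Finsupp.single P (1 : ℤ)))) := by
  classical
  obtain ⟨u, hu0, hu⟩ := P.exists_val_eq_exp (-(D P + 1))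
  rw [relLength, ← ker_leadingCoeffMap S D P hP u hu,
    (LinearMap.quotKerEquivRange _).length_eq]
  have hsurj : Function.Surjective (leadingCoeffMap (↑S) D P hP u hu) := by
    intro y
    obtain ⟨c, rfl⟩ := IsLocalRing.residue_surjective y
    -- approximate `c / u` at `P` and `0` at the other places of `S`
    obtain ⟨z, hz⟩ := Place.exists_val_sub_le S (fun Q => if Q = P then c.1 / u else 0) D
    have hzP : P.val (z - c.1 / u) ≤ WithZero.exp (D P) := by simpa using hz P hP
    have hzu : P.val (z * u - c.1) < 1 := by
      have : z * u - c.1 = (z - c.1 / u) * u := by field_simp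
      rw [this, map_mul, hu]
      calc _ ≤ WithZero.exp (D P) * WithZero.exp (-(D P + 1)) := by gcongr
        _ < 1 := by
          rw [← WithZero.exp_add, ← WithZero.exp_zero, WithZero.exp_lt_exp]; omega
    have hmem : z ∈ boundedSpace (↑S) (D + ⇑(Finsupp.single P (1 : ℤ))) := by
      intro Q hQ
      by_cases hQP : Q = P
      · subst hQP
        rw [Pi.add_apply, Finsupp.single_eq_same]
        have h1 : Q.val (c.1 / u) ≤ WithZero.exp (D Q + 1) := by
          rw [map_div₀, hu, WithZero.exp_neg, div_inv_eq_mul]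
          exact mul_le_of_le_one_left' c.2
        have h2 := Q.val.map_add_le (hzP.trans (WithZero.exp_le_exp.2 (by omega))) h1
        rwa [sub_add_cancel] at h2
      · rw [Pi.add_apply, Finsupp.single_eq_of_ne hQP, add_zero]
        simpa [hQP] using hz Q hQ
    refine ⟨⟨z, hmem⟩, ?_⟩
    rw [← sub_eq_zero]
    change IsLocalRing.residue P.integers _ - _ = 0
    rw [← map_sub, residue_eq_zero_iff_val]
    exact hzu
  rw [LinearMap.range_eq_top.2 hsurj, Module.length_top]

/-- The degree `∑_Q e(Q) deg(Q)` of `e`, with values in `ℕ∞` so that it makes sense before the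
residue fields are known to be finite over `k`. -/
noncomputable def extendedDegree (e : Place k F →₀ ℕ) : ℕ∞ :=
  e.sum fun Q a => a * Module.length k (IsLocalRing.ResidueField Q.integers)

lemma extendedDegree_zero : extendedDegree (0 : Place k F →₀ ℕ) = 0 := Finsupp.sum_zero_index

lemma extendedDegree_add (e e' : Place k F →₀ ℕ) :
    extendedDegree (e + e') = extendedDegree e + extendedDegree e' := by
  classical
  exact Finsupp.sum_add_index' (by simp) (fun Q a b => by push_cast; ring)

lemma extendedDegree_single (P : Place k F) :
    extendedDegree (Finsupp.single P 1) =
      Module.length k (IsLocalRing.ResidueField P.integers) := by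
  rw [extendedDegree, Finsupp.sum_single_index (by simp)]
  simp

lemma finsupp_nat_induction {ι : Type*} {p : (ι →₀ ℕ) → Prop} (e : ι →₀ ℕ) (zero : p 0)
    (add_single : ∀ e P, p e → p (e + Finsupp.single P 1)) : p e := by
  classical
  obtain ⟨s, rfl⟩ := Multiset.toFinsupp.surjective e
  induction s using Multiset.induction_on with
  | empty => simpa using zero
  | cons a s ih =>
    rw [← Multiset.singleton_add, map_add, add_comm, Multiset.toFinsupp_singleton]
    exact add_single _ _ ih

lemma add_natCast_add_single (D : Place k F → ℤ) (e : Place k F →₀ ℕ) (P : Place k F) :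
    (fun Q => D Q + ((e + Finsupp.single P 1 : Place k F →₀ ℕ) Q : ℤ)) =
      (fun Q => D Q + (e Q : ℤ)) + ⇑(Finsupp.single P (1 : ℤ)) := by
  classical
  funext Q
  simp only [Finsupp.add_apply, Pi.add_apply, Finsupp.single_apply]
  split_ifs <;> push_cast <;> ring

lemma relLength_boundedSpace_add_single (S : Set (Place k F)) (D : Place k F → ℤ)
    (e : Place k F →₀ ℕ) (P : Place k F) :
    relLength (boundedSpace S D)
        (boundedSpace S (fun Q => D Q + ((e + Finsupp.single P 1 : Place k F →₀ ℕ) Q : ℤ))) =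
      relLength (boundedSpace S D) (boundedSpace S (fun Q => D Q + (e Q : ℤ))) +
        relLength (boundedSpace S (fun Q => D Q + (e Q : ℤ)))
          (boundedSpace S ((fun Q => D Q + (e Q : ℤ)) + ⇑(Finsupp.single P (1 : ℤ)))) := by
  classical
  rw [add_natCast_add_single]
  refine relLength_add (boundedSpace_mono S (fun Q => by simp))
    (boundedSpace_mono S (fun Q => ?_))
  simp only [Pi.add_apply, Finsupp.single_apply]
  split_ifs <;> simp

lemma relLength_boundedSpace_le (S : Set (Place k F)) (D : Place k F → ℤ) (e : Place k F →₀ ℕ)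
    (he : ∀ Q, e Q ≠ 0 → Q ∈ S) :
    relLength (boundedSpace S D) (boundedSpace S (fun Q => D Q + e Q)) ≤ extendedDegree e := by
  induction e using finsupp_nat_induction with
  | zero => simp [relLength_self]
  | add_single e P ih =>
    rw [relLength_boundedSpace_add_single, extendedDegree_add, extendedDegree_single]
    exact add_le_add (ih fun Q hQ => he Q (by simp [hQ]))
      (relLength_boundedSpace_single_le S _ P (he P (by simp)))

lemma le_relLength_boundedSpace (S : Finset (Place k F)) (D : Place k F → ℤ)
    (e : Place k F →₀ ℕ) (he : ∀ Q, e Q ≠ 0 → Q ∈ S) :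
    extendedDegree e ≤ relLength (boundedSpace ↑S D) (boundedSpace ↑S (fun Q => D Q + e Q)) := by
  induction e using finsupp_nat_induction with
  | zero => simp [extendedDegree_zero]
  | add_single e P ih =>
    rw [relLength_boundedSpace_add_single, extendedDegree_add, extendedDegree_single]
    exact add_le_add (ih fun Q hQ => he Q (by simp [hQ]))
      (le_relLength_boundedSpace_single S _ P (he P (by simp)))

/-! ### Transcendental functions and the degree of `F` over `k(f)` -/

open IntermediateField.algebraAdjoinAdjoin in
/-- `F` is finite over `k(f)` for every transcendental `f`, since `F` has transcendence degree one
and is finitely generated over `k`. -/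
theorem IsFunctionFieldWithFullConstants.finiteDimensional_adjoin
    (hF : IsFunctionFieldWithFullConstants k F) {f : F} (hf : Transcendental k f) :
    FiniteDimensional (IntermediateField.adjoin k ({f} : Set F)) F := by
  obtain ⟨x, -, hfin⟩ := hF.exists_finite
  have h1 : Algebra.EssFiniteType k (IntermediateField.adjoin k ({x} : Set F)) :=
    IntermediateField.essFiniteType_iff.2
      (IntermediateField.fg_adjoin_of_finite (Set.finite_singleton x))
  have h2 : Algebra.EssFiniteType k F :=
    Algebra.EssFiniteType.comp k (IntermediateField.adjoin k ({x} : Set F)) F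
  have h3 : Algebra.EssFiniteType (IntermediateField.adjoin k ({f} : Set F)) F :=
    Algebra.EssFiniteType.of_comp k _ F
  have h4 : Algebra.IsAlgebraic (Algebra.adjoin k ({x} : Set F)) F :=
    (IsFractionRing.comap_isAlgebraic_iff (K := IntermediateField.adjoin k ({x} : Set F))).2
      inferInstance
  have h5 : Algebra.trdeg k F ≤ 1 := by
    simpa using Algebra.IsAlgebraic.trdeg_le_cardinalMk k ({x} : Set F)
  have h6 : AlgebraicIndependent k (fun _ : Unit => f) :=
    algebraicIndependent_unique_type_iff.2 hf
  have h7 : IsTranscendenceBasis k (fun _ : Unit => f) :=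
    h6.isTranscendenceBasis_of_lift_trdeg_le_of_finite (by simpa using h5)
  have h8 := h7.isAlgebraic_field
  rw [Set.range_const] at h8
  exact Algebra.finite_of_essFiniteType_of_isAlgebraic

lemma IsFunctionFieldWithFullConstants.transcendental
    (hF : IsFunctionFieldWithFullConstants k F) {f : F} (hf : f ∉ Set.range (algebraMap k F)) :
    Transcendental k f :=
  fun h => hf (hF.full_constants f h)

lemma ne_zero_of_transcendental {f : F} (hf : Transcendental k f) : f ≠ 0 := by
  rintro rfl
  exact hf isAlgebraic_zero

lemma Place.transcendental_of_ord_ne_zero (hF : IsFunctionFieldWithFullConstants k F)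
    (Q : Place k F) {f : F} (h : Q.ord f ≠ 0) : Transcendental k f := by
  refine hF.transcendental ?_
  rintro ⟨a, rfl⟩
  by_cases ha : a = 0
  · exact h (by simp [ha, Place.ord])
  · exact h (Q.ord_algebraMap ha)

open IntermediateField.algebraAdjoinAdjoin in
/-- If `M` is a `k`-subspace of `F` stable under multiplication by `f`, elements of `M` that are
linearly independent over `k` modulo `f M` are linearly independent over `k(f)`: from a relation
with coefficients in `k[f]` one reads off the vanishing of the constant terms, then divides by
`f`. -/
theorem linearIndependent_adjoin_of_mod {f : F} (hf : f ≠ 0) (M : Submodule k F)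
    (hM : ∀ z ∈ M, f * z ∈ M) {ι : Type*} (u : ι → M)
    (hu : LinearIndependent k
      (((M.map (LinearMap.mulLeft k f)).submoduleOf M).mkQ ∘ u)) :
    LinearIndependent (IntermediateField.adjoin k ({f} : Set F)) (fun i => (u i : F)) := by
  rw [← LinearIndependent.iff_fractionRing (Algebra.adjoin k ({f} : Set F))]
  rw [linearIndependent_iff'] at hu ⊢
  intro s g hg
  have hpoly : ∀ i, ∃ p : Polynomial k, Polynomial.aeval f p = (g i : F) := fun i => by
    have h := Algebra.adjoin_singleton_eq_range_aeval k f
    exact h.le (g i).2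
  choose p hp using hpoly
  have haeval : ∀ (q : Polynomial k), ∀ z ∈ M, Polynomial.aeval f q * z ∈ M := by
    intro q
    induction q using Polynomial.induction_on' with
    | add q r hq hr =>
      intro z hz
      rw [map_add, add_mul]
      exact M.add_mem (hq z hz) (hr z hz)
    | monomial n a =>
      intro z hz
      rw [Polynomial.aeval_monomial, mul_assoc, ← Algebra.smul_def]
      refine M.smul_mem a ?_
      induction n with
      | zero => simpa using hz
      | succ n ih => rw [pow_succ', mul_assoc]; exact hM _ ih
  have key₀ : ∀ q : ι → Polynomial k, ∑ i ∈ s, Polynomial.aeval f (q i) * (u i : F) = 0 →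
      ∀ i ∈ s, (q i).coeff 0 = 0 := by
    intro q hq
    refine hu s (fun i => (q i).coeff 0) ?_
    have h1 : ∑ i ∈ s, (q i).coeff 0 • (u i : F) =
        f * -∑ i ∈ s, Polynomial.aeval f (q i).divX * (u i : F) := by
      rw [← sub_eq_zero, mul_neg, sub_neg_eq_add, Finset.mul_sum, ← Finset.sum_add_distrib,
        ← hq]
      refine Finset.sum_congr rfl fun i _ => ?_
      conv_rhs => rw [← Polynomial.divX_mul_X_add (q i)]
      simp only [map_add, map_mul, Polynomial.aeval_X, Polynomial.aeval_C, Algebra.smul_def]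
      ring
    have h2 : (∑ i ∈ s, (q i).coeff 0 • u i : M) ∈
        (M.map (LinearMap.mulLeft k f)).submoduleOf M := by
      change ((∑ i ∈ s, (q i).coeff 0 • u i : M) : F) ∈ M.map (LinearMap.mulLeft k f)
      rw [Submodule.coe_sum]
      refine ⟨_, M.neg_mem (M.sum_mem (t := s) fun i _ => haeval (q i).divX _ (u i).2), ?_⟩
      exact h1.symm
    rw [← (Submodule.Quotient.mk_eq_zero _).2 h2, ← Submodule.mkQ_apply, map_sum]
    simp
  have key : ∀ (n : ℕ) (q : ι → Polynomial k), ∑ i ∈ s, Polynomial.aeval f (q i) * (u i : F) = 0 →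
      ∀ i ∈ s, (q i).coeff n = 0 := by
    intro n
    induction n with
    | zero => exact key₀
    | succ n ih =>
      intro q hq i hi
      rw [← Polynomial.coeff_divX]
      refine ih (fun i => (q i).divX) ?_ i hi
      refine (mul_eq_zero.1 (?_ : f * _ = 0)).resolve_left hf
      rw [Finset.mul_sum, ← hq]
      refine Finset.sum_congr rfl fun i hi => ?_
      conv_rhs => rw [← Polynomial.divX_mul_X_add (q i)]
      rw [key₀ q hq i hi]
      simp only [map_mul, Polynomial.aeval_X, map_zero, add_zero]
      ring
  intro i hi
  have h1 : p i = 0 := by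
    ext n
    rw [Polynomial.coeff_zero]
    refine key n p ?_ i hi
    rw [← hg]
    refine Finset.sum_congr rfl fun i _ => ?_
    rw [hp]
    rfl
  exact Subtype.ext (by rw [← hp, h1, map_zero]; rfl)

/-- `dim_k (M / f M) ≤ [F : k(f)]` for every `k`-subspace `M` stable under multiplication
by `f`. -/
theorem relLength_mul_le (hF : IsFunctionFieldWithFullConstants k F) {f : F}
    (hf : Transcendental k f) (M : Submodule k F) (hM : ∀ z ∈ M, f * z ∈ M) :
    relLength (M.map (LinearMap.mulLeft k f)) M ≤
      Module.finrank (IntermediateField.adjoin k ({f} : Set F)) F := by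
  have := hF.finiteDimensional_adjoin hf
  have h1 : Module.rank k (M ⧸ (M.map (LinearMap.mulLeft k f)).submoduleOf M) ≤
      (Module.finrank (IntermediateField.adjoin k ({f} : Set F)) F : ℕ) := by
    refine rank_le fun s hs => ?_
    choose u hu using fun y : s => Submodule.mkQ_surjective _ y.1
    have h2 := linearIndependent_adjoin_of_mod (ne_zero_of_transcendental hf) M hM u
      (by convert hs using 2 with y; exact hu y)
    simpa using h2.fintype_card_le_finrank
  rw [relLength, Module.length_eq_rank]
  exact (Cardinal.toENat.monotone' h1).trans (by simp)

/-! ### Existence of places -/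

lemma module_finite_of_length_ne_top {M : Type*} [AddCommGroup M] [Module k M]
    (h : Module.length k M ≠ ⊤) : Module.Finite k M := by
  rw [Module.length_ne_top_iff, isFiniteLength_iff_isNoetherian_isArtinian] at h
  have := h.1
  infer_instance

/-- Every `k`-subalgebra `A` of `F` is Noetherian, because `A / a A` is finite-dimensional over `k`
for every nonzero non-unit `a` of `A`. -/
theorem IsFunctionFieldWithFullConstants.isNoetherianRing_subalgebra
    (hF : IsFunctionFieldWithFullConstants k F) (A : Subalgebra k F) : IsNoetherianRing A := by
  refine ⟨fun I => ?_⟩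
  by_cases hI : I = ⊥
  · rw [hI]; exact Submodule.fg_bot
  obtain ⟨a, haI, ha⟩ := Submodule.exists_mem_ne_zero_of_ne_bot hI
  have ha' : (a : F) ≠ 0 := fun h => ha (Subtype.ext h)
  by_cases hr : (a : F) ∈ Set.range (algebraMap k F)
  · obtain ⟨c, hc⟩ := hr
    have hc0 : c ≠ 0 := by rintro rfl; exact ha' (by rw [← hc, map_zero])
    have hu : IsUnit a := by
      have : a = algebraMap k A c := Subtype.ext hc.symm
      rw [this]
      exact (IsUnit.mk0 c hc0).map _
    rw [Ideal.eq_top_of_isUnit_mem I haI hu]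
    exact (Ideal.fg_top A)
  · let M : Submodule k F := Subalgebra.toSubmodule A
    have h1 := relLength_mul_le hF (hF.transcendental hr) M (fun z hz => A.mul_mem a.2 hz)
    have h2 : Module.Finite k (M ⧸ (M.map (LinearMap.mulLeft k (a : F))).submoduleOf M) :=
      module_finite_of_length_ne_top (ne_top_of_le_ne_top (ENat.natCast_ne_top _) h1)
    let φ : M →ₗ[k] (A ⧸ Ideal.span {a}) := (Ideal.Quotient.mkₐ k (Ideal.span {a})).toLinearMap
    let ψ : (M ⧸ (M.map (LinearMap.mulLeft k (a : F))).submoduleOf M) →ₗ[k]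
        (A ⧸ Ideal.span {a}) := by
      refine Submodule.liftQ _ φ ?_
      rintro x ⟨y, hy, hxy⟩
      change Ideal.Quotient.mk (Ideal.span {a}) x = 0
      rw [Ideal.Quotient.eq_zero_iff_mem, Ideal.mem_span_singleton]
      exact ⟨⟨y, hy⟩, Subtype.ext hxy.symm⟩
    have hψ : Function.Surjective ψ := by
      intro y
      obtain ⟨y, rfl⟩ := Ideal.Quotient.mk_surjective y
      exact ⟨Submodule.mkQ _ y, rfl⟩
    have h3 : Module.Finite k (A ⧸ Ideal.span {a}) := Module.Finite.of_surjective ψ hψ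
    have h4 : IsNoetherian A (A ⧸ Ideal.span {a}) := isNoetherian_of_tower k inferInstance
    refine Submodule.fg_of_fg_map_of_fg_inf_ker (Ideal.span {a}).mkQ
      (IsNoetherian.noetherian _) ?_
    rw [Submodule.ker_mkQ, inf_eq_right.2 ((Ideal.span_singleton_le_iff_mem I).2 haI)]
    exact ⟨{a}, by simp [Ideal.span]⟩

/-- A valuation ring `V` of `F` containing `k` but not `f` is Noetherian, hence discrete, and its
valuation is a place at which `f` has a pole. -/
theorem IsFunctionFieldWithFullConstants.exists_place_of_valuationSubring
    (hF : IsFunctionFieldWithFullConstants k F) (V : ValuationSubring F)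
    (hV : ∀ a : k, algebraMap k F a ∈ V) {f : F} (hf : f ∉ V) :
    ∃ Q : Place k F, Q.ord f < 0 := by
  have hf0 : f ≠ 0 := by rintro rfl; exact hf V.zero_mem
  have hfi : f⁻¹ ∈ V := (V.mem_or_inv_mem f).resolve_left hf
  let A : Subalgebra k F := { V.toSubring with algebraMap_mem' := hV }
  have hA : IsNoetherianRing A := hF.isNoetherianRing_subalgebra A
  have hN : IsNoetherianRing V := hA
  have hP : IsPrincipalIdealRing V := (IsBezout.TFAE.out 0 1).1 hN
  have hnu : ¬ IsUnit (⟨f⁻¹, hfi⟩ : V) := by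
    intro h
    obtain ⟨w, hw⟩ := h.exists_right_inv
    have h1 : f⁻¹ * (w : F) = 1 := congrArg Subtype.val hw
    have h2 : (w : F) = f := by field_simp at h1; exact h1
    exact hf (h2 ▸ w.2)
  have hnf : IsLocalRing.maximalIdeal V ≠ ⊥ := by
    intro h
    have h1 : (⟨f⁻¹, hfi⟩ : V) ∈ IsLocalRing.maximalIdeal V :=
      (IsLocalRing.mem_maximalIdeal _).2 hnu
    rw [h, Ideal.mem_bot] at h1
    exact inv_ne_zero hf0 (congrArg Subtype.val h1)
  have hD : IsDiscreteValuationRing V := { not_a_field' := hnf }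
  let v := IsDiscreteValuationRing.maximalIdeal V
  have hle : ∀ a : k, v.valuation F (algebraMap k F a) ≤ 1 := fun a =>
    v.valuation_le_one (⟨algebraMap k F a, hV a⟩ : V)
  let Q : Place k F :=
    { val := v.valuation F
      surjective_val := v.valuation_surjective F
      val_algebraMap := fun a ha => by
        refine le_antisymm (hle a) ?_
        have h1 := hle a⁻¹
        rw [map_inv₀, map_inv₀] at h1
        refine (inv_le_one₀ ?_).1 h1
        rw [zero_lt_iff]
        exact (Valuation.ne_zero_iff _).2 (by simpa using ha) }
  refine ⟨Q, ?_⟩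
  have h1 : Q.val f⁻¹ < 1 :=
    (v.valuation_lt_one_iff_mem (K := F) (⟨f⁻¹, hfi⟩ : V)).2
      ((IsLocalRing.mem_maximalIdeal _).2 hnu)
  rw [Q.val_eq_exp_neg_ord (inv_ne_zero hf0), ← WithZero.exp_zero, WithZero.exp_lt_exp,
    Place.ord_inv] at h1
  omega

/-- A nonconstant function has a pole, because `k` is integrally closed in `F` and hence an
intersection of valuation rings. -/
theorem IsFunctionFieldWithFullConstants.exists_pole
    (hF : IsFunctionFieldWithFullConstants k F) {f : F}
    (hf : f ∉ Set.range (algebraMap k F)) : ∃ Q : Place k F, Q.ord f < 0 := by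
  let R : Subring F := (algebraMap k F).range
  have hR : IsIntegrallyClosedIn R F := by
    rw [Subring.isIntegrallyClosedIn_iff]
    intro z hz
    refine hF.full_constants z (IsIntegral.isAlgebraic ?_)
    obtain ⟨p, hp, hpz⟩ := hz
    obtain ⟨q, hq, -, hqm⟩ := Polynomial.lifts_and_natDegree_eq_and_monic
      (Polynomial.mem_lifts_of_surjective (algebraMap k F).rangeRestrict_surjective p) hp
    refine ⟨q, hqm, ?_⟩
    rw [← hpz, ← hq, Polynomial.eval₂_map]
    rfl
  obtain ⟨V, hRV, hfV⟩ := R.exists_le_valuationSubring_of_isIntegrallyClosedIn (x := f) hf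
  exact hF.exists_place_of_valuationSubring V (fun a => hRV ⟨a, rfl⟩) hfV

/-! ### Finiteness of zeros and poles, and the degree of a principal divisor -/

/-- A transcendental function has at most `[F : k(f)]` zeros, counted with multiplicity and
degree. -/
lemma IsFunctionFieldWithFullConstants.extendedDegree_le
    (hF : IsFunctionFieldWithFullConstants k F) {f : F} (hf : Transcendental k f)
    (e : Place k F →₀ ℕ) (he : ∀ Q, e Q ≠ 0 → (e Q : ℤ) ≤ Q.ord f) :
    extendedDegree e ≤ Module.finrank (IntermediateField.adjoin k ({f} : Set F)) F := by
  have hf0 := ne_zero_of_transcendental hf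
  let S := e.support
  let M : Submodule k F := boundedSpace (↑S) (fun _ => 0)
  let M' : Submodule k F := boundedSpace (↑S) (fun Q => -(e Q : ℤ))
  have hle : ∀ Q ∈ S, Q.val f ≤ WithZero.exp (-(e Q : ℤ)) := fun Q hQ => by
    rw [Q.val_le_exp_iff hf0, neg_neg]
    exact he Q (Finsupp.mem_support_iff.1 hQ)
  have hmul : ∀ z ∈ M, f * z ∈ M' := fun z hz Q hQ => by
    rw [map_mul]
    exact (mul_le_of_le_one_right' (hz Q hQ)).trans (hle Q hQ)
  have hM'M : M' ≤ M := boundedSpace_mono _ (fun Q => by simp)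
  have h1 : extendedDegree e ≤ relLength M' M := by
    have := le_relLength_boundedSpace S (fun Q => -(e Q : ℤ)) e
      (fun Q hQ => Finsupp.mem_support_iff.2 hQ)
    simpa using this
  have h2 : M.map (LinearMap.mulLeft k f) ≤ M' := by
    rintro _ ⟨z, hz, rfl⟩
    exact hmul z hz
  refine h1.trans (le_trans ?_ (relLength_mul_le hF hf M fun z hz => hM'M (hmul z hz)))
  rw [relLength_add h2 hM'M]
  exact le_add_self

lemma IsFunctionFieldWithFullConstants.finite_residueField
    (hF : IsFunctionFieldWithFullConstants k F) (Q : Place k F) :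
    Module.Finite k (IsLocalRing.ResidueField Q.integers) := by
  obtain ⟨f, -, hf⟩ := Q.exists_val_eq_exp (-1)
  have hord : Q.ord f = 1 := by rw [Q.ord_eq_of_val_eq hf, neg_neg]
  have h1 := hF.extendedDegree_le
    (Q.transcendental_of_ord_ne_zero hF (by rw [hord]; exact one_ne_zero))
    (Finsupp.single Q 1) (fun P hP => by
      by_cases h : P = Q
      · rw [h, hord]; simp
      · exact absurd (Finsupp.single_eq_of_ne h) hP)
  rw [extendedDegree_single] at h1
  exact module_finite_of_length_ne_top (ne_top_of_le_ne_top (ENat.natCast_ne_top _) h1)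

/-- The degree `∑_Q e(Q) deg(Q)` of an effective divisor, as a natural number. -/
noncomputable def natDegree (e : Place k F →₀ ℕ) : ℕ := e.sum fun Q a => a * Q.degree

lemma IsFunctionFieldWithFullConstants.extendedDegree_eq
    (hF : IsFunctionFieldWithFullConstants k F) (e : Place k F →₀ ℕ) :
    extendedDegree e = natDegree e := by
  rw [extendedDegree, natDegree, Finsupp.sum, Finsupp.sum, Nat.cast_sum]
  refine Finset.sum_congr rfl fun Q _ => ?_
  have := hF.finite_residueField Q
  rw [Module.length_eq_finrank, Nat.cast_mul]
  rfl

lemma IsFunctionFieldWithFullConstants.degree_pos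
    (hF : IsFunctionFieldWithFullConstants k F) (Q : Place k F) : 0 < Q.degree := by
  have := hF.finite_residueField Q
  exact Module.finrank_pos

lemma IsFunctionFieldWithFullConstants.finite_zeros
    (hF : IsFunctionFieldWithFullConstants k F) (f : F) :
    {Q : Place k F | 0 < Q.ord f}.Finite := by
  classical
  by_contra hinf
  obtain ⟨Q₀, hQ₀⟩ := Set.Infinite.nonempty hinf
  have htr := Q₀.transcendental_of_ord_ne_zero hF (ne_of_gt hQ₀)
  obtain ⟨S, hS, hcard⟩ := Set.Infinite.exists_subset_card_eq hinf
    (Module.finrank (IntermediateField.adjoin k ({f} : Set F)) F + 1)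
  let e : Place k F →₀ ℕ := Finsupp.indicator S (fun _ _ => 1)
  have he1 : ∀ Q ∈ S, e Q = 1 := fun Q hQ => Finsupp.indicator_of_mem hQ _
  have he0 : ∀ Q, Q ∉ S → e Q = 0 := fun Q hQ => Finsupp.indicator_of_notMem hQ _
  have h1 := hF.extendedDegree_le htr e (fun Q hQ => by
    have hQS : Q ∈ S := by by_contra h; exact hQ (he0 Q h)
    rw [he1 Q hQS]
    exact hS hQS)
  rw [hF.extendedDegree_eq, Nat.cast_le, natDegree, Finsupp.sum_of_support_subset e
    (s := S) (fun Q hQ => by by_contra h; exact Finsupp.mem_support_iff.1 hQ (he0 Q h))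
    _ (by simp)] at h1
  have h2 : S.card ≤ ∑ Q ∈ S, e Q * Q.degree := by
    rw [Finset.card_eq_sum_ones]
    refine Finset.sum_le_sum fun Q hQ => ?_
    rw [he1 Q hQ, one_mul]
    exact hF.degree_pos Q
  omega

/-- Every function `f ≠ 0` has a divisor `(f)`. (For `f = 0` the orders have the value `0`, so the
statement holds trivially.) -/
theorem IsFunctionFieldWithFullConstants.exists_divisor
    (hF : IsFunctionFieldWithFullConstants k F) (f : F) :
    ∃ D : Divisor k F, ∀ Q, D Q = Q.ord f := by
  have hfin : (Function.support fun Q : Place k F => Q.ord f).Finite := by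
    refine ((hF.finite_zeros f).union (hF.finite_zeros f⁻¹)).subset fun Q hQ => ?_
    have hQ' : Q.ord f ≠ 0 := hQ
    rcases lt_or_gt_of_ne hQ' with h | h
    · right
      change 0 < Q.ord f⁻¹
      rw [Q.ord_inv]
      omega
    · left; exact h
  exact ⟨Finsupp.ofSupportFinite _ hfin, fun Q => rfl⟩

/-- `dim L(e) ≤ 1 + deg e` for an effective divisor `e`. -/
lemma IsFunctionFieldWithFullConstants.length_boundedSpace_le
    (hF : IsFunctionFieldWithFullConstants k F) (e : Place k F →₀ ℕ) :
    Module.length k (boundedSpace Set.univ (fun Q : Place k F => (e Q : ℤ))) ≤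
      1 + natDegree e := by
  have h0 : Module.length k (boundedSpace Set.univ (fun _ : Place k F => (0 : ℤ))) ≤ 1 := by
    have hconst : ∀ z : boundedSpace Set.univ (fun _ : Place k F => (0 : ℤ)),
        ∃ a : k, algebraMap k F a = z := by
      intro z
      by_contra h
      obtain ⟨Q, hQ⟩ := hF.exists_pole (f := z.1) h
      have hz0 : z.1 ≠ 0 := by
        intro hz
        rw [hz] at hQ
        simp [Place.ord] at hQ
      have := (Q.val_le_exp_iff hz0 0).1 (z.2 Q (Set.mem_univ _))
      omega
    choose g hg using hconst
    let γ : boundedSpace Set.univ (fun _ : Place k F => (0 : ℤ)) →ₗ[k] k :=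
      { toFun := g
        map_add' := fun x y => (algebraMap k F).injective (by
          rw [map_add, hg, hg, hg]; rfl)
        map_smul' := fun a x => (algebraMap k F).injective (by
          rw [RingHom.id_apply, smul_eq_mul, map_mul, hg, hg, ← Algebra.smul_def]; rfl) }
    have hγ : Function.Injective γ := fun x y hxy =>
      Subtype.ext (by rw [← hg x, ← hg y]; exact congrArg _ hxy)
    refine (Module.length_le_of_injective γ hγ).trans ?_
    rw [Module.length_eq_finrank, Module.finrank_self, Nat.cast_one]
  have h1 := relLength_boundedSpace_le (k := k) (F := F) Set.univ (fun _ => 0) e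
    (fun Q _ => Set.mem_univ _)
  simp only [zero_add] at h1
  rw [← relLength_bot] at h0 ⊢
  rw [relLength_add bot_le (boundedSpace_mono _ (D := fun _ => 0) (fun Q => by simp)),
    ← hF.extendedDegree_eq]
  exact add_le_add h0 h1

lemma natDegree_add (e e' : Place k F →₀ ℕ) :
    natDegree (e + e') = natDegree e + natDegree e' := by
  classical
  exact Finsupp.sum_add_index' (by simp) (fun Q a b => add_mul _ _ _)

lemma natDegree_nsmul (r : ℕ) (e : Place k F →₀ ℕ) : natDegree (r • e) = r * natDegree e := by
  induction r with
  | zero => simp [natDegree]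
  | succ r ih => rw [add_smul, one_smul, natDegree_add, ih]; ring

/-- A transcendental function has at least `[F : k(f)]` poles, counted with multiplicity and degree:
for a basis `u_j` of `F` over `k(f)` the functions `f^i u_j`, `i ≤ r`, are linearly independent and
their poles are bounded by `r e + c` with `c` independent of `r`. -/
lemma IsFunctionFieldWithFullConstants.finrank_le_natDegree
    (hF : IsFunctionFieldWithFullConstants k F) {f : F} (hf : Transcendental k f)
    (e : Place k F →₀ ℕ) (he : ∀ Q, -Q.ord f ≤ e Q) :
    Module.finrank (IntermediateField.adjoin k ({f} : Set F)) F ≤ natDegree e := by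
  have hf0 := ne_zero_of_transcendental hf
  have hfd := hF.finiteDimensional_adjoin hf
  set K := IntermediateField.adjoin k ({f} : Set F)
  set N := Module.finrank K F
  let u := Module.finBasis K F
  have hu0 : ∀ j, u j ≠ 0 := fun j => u.ne_zero j
  choose D hD using fun j => hF.exists_divisor (u j)
  let c : Place k F →₀ ℕ := ∑ j, (D j).mapRange (fun a => (-a).toNat) (by simp)
  have hc : ∀ j Q, -Q.ord (u j) ≤ c Q := by
    intro j Q
    have h1 : (-(D j Q)).toNat ≤ c Q := by
      simp only [c, Finsupp.finsetSum_apply, Finsupp.mapRange_apply]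
      exact Finset.single_le_sum (f := fun j => (-(D j Q)).toNat) (fun _ _ => Nat.zero_le _)
        (Finset.mem_univ j)
    rw [← hD]
    omega
  have key : ∀ r : ℕ, (r + 1) * N ≤ 1 + (r * natDegree e + natDegree c) := by
    intro r
    let fK : K := ⟨f, IntermediateField.mem_adjoin_simple_self k f⟩
    have hpow : LinearIndependent k (fun i : Fin (r + 1) => fK ^ (i : ℕ)) := by
      have h1 : LinearIndependent k (fun i : ℕ => f ^ i) :=
        by
          have h0 : (fun i : ℕ => f ^ i) =
              (Polynomial.aeval f).toLinearMap ∘ (Polynomial.basisMonomials k) := by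
            funext i
            simp
          rw [h0]
          exact (Polynomial.basisMonomials k).linearIndependent.map' _
            (LinearMap.ker_eq_bot.2 (transcendental_iff_injective.1 hf))
      have h2 := h1.comp (fun i : Fin (r + 1) => (i : ℕ)) Fin.val_injective
      exact LinearIndependent.of_comp K.val.toLinearMap h2
    have hli := linearIndependent_smul hpow u.linearIndependent
    have hmem : ∀ p : Fin (r + 1) × Fin N, fK ^ (p.1 : ℕ) • u p.2 ∈
        boundedSpace Set.univ (fun Q : Place k F => ((r • e + c) Q : ℤ)) := by
      intro p Q _
      change Q.val (f ^ (p.1 : ℕ) * u p.2) ≤ _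
      have h1 : Q.val (f ^ (p.1 : ℕ)) ≤ WithZero.exp (r * e Q : ℤ) := by
        have h2 : Q.val f ≤ WithZero.exp (e Q : ℤ) := by
          rw [Q.val_le_exp_iff hf0]
          have := he Q
          omega
        rw [map_pow]
        calc Q.val f ^ (p.1 : ℕ) ≤ WithZero.exp (e Q : ℤ) ^ (p.1 : ℕ) := by gcongr
          _ = WithZero.exp ((p.1 : ℕ) * e Q : ℤ) := by
            rw [← WithZero.exp_nsmul, nsmul_eq_mul]
          _ ≤ _ := by
            rw [WithZero.exp_le_exp]
            have : ((p.1 : ℕ) : ℤ) ≤ r := by have := p.1.2; omega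
            gcongr
      have h3 : Q.val (u p.2) ≤ WithZero.exp (c Q : ℤ) := by
        rw [Q.val_le_exp_iff (hu0 _)]
        have := hc p.2 Q
        omega
      rw [map_mul]
      refine (mul_le_mul' h1 h3).trans ?_
      rw [← WithZero.exp_add]
      simp
    have hli' : LinearIndependent k (fun p => (⟨_, hmem p⟩ :
        boundedSpace Set.univ (fun Q : Place k F => ((r • e + c) Q : ℤ)))) :=
      LinearIndependent.of_comp (Submodule.subtype _) hli
    have hlen := hF.length_boundedSpace_le (r • e + c)
    have hfin := module_finite_of_length_ne_top
      (ne_top_of_le_ne_top (ENat.natCast_ne_top (1 + natDegree (r • e + c))) (by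
        push_cast; exact hlen))
    rw [Module.length_eq_finrank] at hlen
    have h4 := hli'.fintype_card_le_finrank
    rw [Fintype.card_prod, Fintype.card_fin, Fintype.card_fin] at h4
    have h5 : Module.finrank k
        (boundedSpace Set.univ (fun Q : Place k F => ((r • e + c) Q : ℤ))) ≤
        1 + natDegree (r • e + c) := by
      exact_mod_cast hlen
    rw [natDegree_add, natDegree_nsmul] at h5
    exact h4.trans h5
  -- for large `r` the linear growth rates must compare
  by_contra hlt
  have h1 := key (1 + natDegree c)
  have h2 : natDegree e + 1 ≤ N := by omega
  have h3 := Nat.mul_le_mul_left (1 + natDegree c + 1) h2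
  nlinarith

/-- A principal divisor has degree zero. -/
theorem IsFunctionFieldWithFullConstants.degree_eq_zero
    (hF : IsFunctionFieldWithFullConstants k F) {f : F} {D : Divisor k F}
    (hD : ∀ Q, D Q = Q.ord f) : Divisor.degree D = 0 := by
  classical
  by_cases hr : f ∈ Set.range (algebraMap k F)
  · obtain ⟨a, rfl⟩ := hr
    have : D = 0 := by
      ext Q
      rw [hD, Finsupp.zero_apply]
      by_cases ha : a = 0
      · simp [ha, Place.ord]
      · exact Q.ord_algebraMap ha
    rw [this, map_zero]
  have hf := hF.transcendental hr
  have hfi : Transcendental k f⁻¹ := fun h => hf (by simpa using h.inv)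
  let zeros : Place k F →₀ ℕ := D.mapRange Int.toNat (by simp)
  let poles : Place k F →₀ ℕ := D.mapRange (fun a => (-a).toNat) (by simp)
  have hz : ∀ Q, zeros Q = (Q.ord f).toNat := fun Q => by simp [zeros, hD]
  have hp : ∀ Q, poles Q = (-Q.ord f).toNat := fun Q => by simp [poles, hD]
  have upper : ∀ (g : F) (e : Place k F →₀ ℕ), Transcendental k g →
      (∀ Q, e Q = (Q.ord g).toNat) →
      natDegree e ≤ Module.finrank (IntermediateField.adjoin k ({g} : Set F)) F := by
    intro g e hg he
    have h := hF.extendedDegree_le hg e (fun Q hQ => by rw [he] at hQ ⊢; omega)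
    rw [hF.extendedDegree_eq] at h
    exact_mod_cast h
  have h1 : natDegree zeros ≤ natDegree poles :=
    (upper f zeros hf hz).trans (hF.finrank_le_natDegree hf poles (fun Q => by rw [hp]; omega))
  have h2 : natDegree poles ≤ natDegree zeros :=
    (upper f⁻¹ poles hfi (fun Q => by rw [hp, Q.ord_inv])).trans
      (hF.finrank_le_natDegree hfi zeros (fun Q => by rw [hz, Q.ord_inv]; omega))
  have h3 : Divisor.degree D = (natDegree zeros : ℤ) - natDegree poles := by
    change Finsupp.linearCombination ℤ (fun Q : Place k F => (Q.degree : ℤ)) D = _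
    rw [Finsupp.linearCombination_apply, Finsupp.sum, natDegree, natDegree,
      Finsupp.sum_of_support_subset zeros (s := D.support) Finsupp.support_mapRange _ (by simp),
      Finsupp.sum_of_support_subset poles (s := D.support) Finsupp.support_mapRange _ (by simp),
      Nat.cast_sum, Nat.cast_sum, ← Finset.sum_sub_distrib]
    refine Finset.sum_congr rfl fun Q _ => ?_
    rw [hz, hp, hD]
    push_cast
    rw [smul_eq_mul, ← sub_mul]
    congr 1
    omega
  omega

/-! ### Existence of a distinguished divisor -/

variable {n m : ℕ}

lemma Divisor.degree_single (Q : Place k F) (a : ℤ) :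
    Divisor.degree (Finsupp.single Q a) = a * Q.degree := by
  change Finsupp.linearCombination ℤ (fun Q : Place k F => (Q.degree : ℤ)) _ = _
  rw [Finsupp.linearCombination_single, smul_eq_mul]

/-- Some function `g ≠ 0` makes the support of `B + (g)` disjoint from a given finite nonempty set
of places. -/
theorem exists_ord_eq_neg (S : Finset (Place k F)) (hS : S.Nonempty) (B : Divisor k F) :
    ∃ g : F, g ≠ 0 ∧ ∀ Q ∈ S, Q.ord g = -B Q := by
  choose u hu0 hu using fun Q : Place k F => Q.exists_val_eq_exp (B Q)
  obtain ⟨z, hz⟩ := Place.exists_val_sub_le S u (fun Q => B Q - 1)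
  have hval : ∀ Q ∈ S, Q.val z = WithZero.exp (B Q) := fun Q hQ => by
    rw [← hu Q]
    refine Q.val.map_eq_of_sub_lt ((hz Q hQ).trans_lt ?_)
    rw [hu Q, WithZero.exp_lt_exp]
    omega
  refine ⟨z, ?_, fun Q hQ => Q.ord_eq_of_val_eq (hval Q hQ)⟩
  obtain ⟨Q, hQ⟩ := hS
  exact (Valuation.ne_zero_iff Q.val).1 (by rw [hval Q hQ]; exact WithZero.exp_ne_zero)

lemma restrictDivisor_congr (P : Fin n → Place k F) {E E' : Place k F → ℤ}
    (h : ∀ i, E (P i) = E' (P i)) : restrictDivisor P m E = restrictDivisor P m E' := by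
  simp only [restrictDivisor, h]

lemma jCount_congr (P : Fin n → Place k F) {E E' : Place k F → ℤ}
    (h : ∀ i, E (P i) = E' (P i)) : jCount P m E = jCount P m E' := by
  funext l
  simp only [jCount, h]

/-- Fewer than `h` divisors in `V_m(r, s; X)` cannot represent all `h` divisor classes of degree
`r`. A class without a representative in `V_m(r, s; X)` contains a divisor `G` prime to the `P_i`;
for `f ∈ L(G)` the divisor `G + (f)` is effective, lies in this class, and agrees with `(f)_0` at
the `P_i`. -/
theorem IsFunctionFieldWithFullConstants.exists_isDistinguished
    (hF : IsFunctionFieldWithFullConstants k F) (hn : 1 ≤ n) (P : Fin n → Place k F)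
    (hPr : ∀ i, (P i).IsRational) {r s : ℕ} (X : Fin m → ℕ)
    (hV : (divisorSet P r s X).encard < (classNumber k F : ℕ∞)) :
    ∃ G : Divisor k F, IsDistinguished P r s X G := by
  classical
  let B₀ : Divisor k F := Finsupp.single (P ⟨0, hn⟩) (r : ℤ)
  have hB₀ : Divisor.degree B₀ = r := by
    rw [Divisor.degree_single, show (P ⟨0, hn⟩).degree = 1 from hPr _]; simp
  let cls : divisorSet P r s X → (Divisor.degreeZero (k := k) (F := F)) ⧸
      (Divisor.principal (k := k) (F := F)).addSubgroupOf Divisor.degreeZero := fun D =>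
    QuotientAddGroup.mk ⟨D.1 - B₀, by
      rw [Divisor.degreeZero, AddMonoidHom.mem_ker, map_sub, hB₀, D.2.2.1, sub_self]⟩
  have hfin : (divisorSet P r s X).Finite :=
    Set.encard_lt_top_iff.1 (hV.trans (ENat.natCast_lt_top _))
  have hns : ¬ Function.Surjective cls := by
    intro hsurj
    have := hfin.to_subtype
    have h1 := Nat.card_le_card_of_surjective cls hsurj
    rw [← hfin.cast_ncard_eq, Nat.cast_lt] at hV
    rw [Nat.card_coe_set_eq] at h1
    exact absurd h1 (not_le.2 hV)
  obtain ⟨q, hq⟩ := not_forall.1 hns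
  obtain ⟨⟨A, hA⟩, rfl⟩ := QuotientAddGroup.mk_surjective q
  have hA0 : Divisor.degree A = 0 := hA
  obtain ⟨g, hg0, hg⟩ := exists_ord_eq_neg (Finset.univ.image P)
    ⟨P ⟨0, hn⟩, Finset.mem_image_of_mem _ (Finset.mem_univ _)⟩ (A + B₀)
  obtain ⟨Dg, hDg⟩ := hF.exists_divisor g
  have hGP : ∀ i, (A + B₀ + Dg) (P i) = 0 := fun i => by
    rw [Finsupp.add_apply, hDg, hg _ (Finset.mem_image_of_mem _ (Finset.mem_univ i))]
    omega
  have hGdeg : Divisor.degree (A + B₀ + Dg) = r := by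
    rw [map_add, map_add, hA0, hB₀, hF.degree_eq_zero hDg]; ring
  refine ⟨A + B₀ + Dg, hGdeg, hGP, fun f hf hf0 hcount hsum => ?_⟩
  by_contra hlt
  obtain ⟨Df, hDf⟩ := hF.exists_divisor f
  have hpos : ∀ Q, 0 ≤ (A + B₀ + Dg + Df) Q := fun Q => by
    have h1 := (Q.val_le_exp_iff hf0 _).1 (hf Q)
    rw [Finsupp.add_apply, hDf]
    omega
  have hagree : ∀ i, (A + B₀ + Dg + Df) (P i) = zeroOrders f (P i) := fun i => by
    have h1 := hpos (P i)
    rw [Finsupp.add_apply, hGP, hDf] at h1 ⊢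
    rw [zeroOrders]
    omega
  have hmem : A + B₀ + Dg + Df ∈ divisorSet P r s X := by
    refine ⟨fun Q => hpos Q, ?_, ?_, ?_, ?_⟩
    · rw [map_add, hGdeg, hF.degree_eq_zero hDf, add_zero]
    · rw [restrictDivisor_congr P hagree]
      omega
    · intro l
      rw [jCount_congr P hagree]
      exact hcount l
    · rw [SumBound, jSum, jCount_congr P hagree]
      exact hsum
  refine hq ⟨⟨_, hmem⟩, ?_⟩
  rw [QuotientAddGroup.eq]
  change -(A + B₀ + Dg + Df - B₀) + A ∈ Divisor.principal
  have h1 : -(A + B₀ + Dg + Df - B₀) + A = -(Dg + Df) := by abel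
  rw [h1]
  exact neg_mem (add_mem ⟨g, hg0, hDg⟩ ⟨f, hf0, hDf⟩)

/-! ### Averaging over translates -/

/-- For a map `Φ` from a finite set to a finite group, some translate of `M` contains at least the
average number of values of `Φ`. -/
theorem exists_translate_card_ge {T V : Type*} [Finite T] [AddCommGroup V] [Finite V]
    (Φ : T → V) (M : Set V) :
    ∃ c : V, (Nat.card T : ℝ) * (M.ncard : ℝ) / (Nat.card V : ℝ) ≤
      ({f | Φ f - c ∈ M}.ncard : ℝ) := by
  classical
  have := Fintype.ofFinite T
  have := Fintype.ofFinite V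
  have hV : (0 : ℝ) < Nat.card V := by exact_mod_cast Nat.card_pos
  have hcount : ∀ c : V, {f | Φ f - c ∈ M}.ncard = ∑ f : T, if Φ f - c ∈ M then 1 else 0 := by
    intro c
    rw [Set.ncard_eq_toFinset_card', Finset.card_eq_sum_ones, ← Finset.sum_filter]
    congr 1
    ext f
    simp
  have htotal : ∑ c : V, {f | Φ f - c ∈ M}.ncard = Nat.card T * M.ncard := by
    simp_rw [hcount]
    rw [Finset.sum_comm]
    have h1 : ∀ f : T, ∑ c : V, (if Φ f - c ∈ M then 1 else 0) = M.ncard := by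
      intro f
      have h2 := (Equiv.subLeft (Φ f)).sum_comp (fun v => if v ∈ M then 1 else 0)
      simp only [Equiv.subLeft_apply] at h2
      rw [h2, Set.ncard_eq_toFinset_card', Finset.card_eq_sum_ones, ← Finset.sum_filter]
      congr 1
      ext v
      simp
    simp_rw [h1]
    rw [Finset.sum_const, smul_eq_mul, Finset.card_univ, Nat.card_eq_fintype_card]
  by_contra! hlt
  have h2 : ∑ c : V, ({f | Φ f - c ∈ M}.ncard : ℝ) <
      ∑ _c : V, (Nat.card T : ℝ) * (M.ncard : ℝ) / (Nat.card V : ℝ) :=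
    Finset.sum_lt_sum_of_nonempty Finset.univ_nonempty (fun c _ => hlt c)
  rw [Finset.sum_const, Finset.card_univ, ← Nat.card_eq_fintype_card, nsmul_eq_mul,
    mul_div_cancel₀ _ hV.ne', ← Nat.cast_sum, htotal, Nat.cast_mul] at h2
  exact lt_irrefl _ h2

/-! ### Last nonzero coordinates of a difference -/

section LastNonzero

variable {α β : Fin n → Fin m → k} {l : Fin m} {i : Fin n}

lemma mem_lastNonzero :
    i ∈ lastNonzero α l ↔ (∀ l', l < l' → α i l' = 0) ∧ α i l ≠ 0 := by
  simp [lastNonzero]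

lemma eq_of_mem_lastNonzero {l' : Fin m} (h : i ∈ lastNonzero α l) (h' : i ∈ lastNonzero α l') :
    l = l' := by
  rw [mem_lastNonzero] at h h'
  rcases lt_trichotomy l l' with hl | hl | hl
  · exact absurd (h.1 _ hl) h'.2
  · exact hl
  · exact absurd (h'.1 _ hl) h.2

lemma exists_mem_lastNonzero (h : α i l ≠ 0) : ∃ l', l ≤ l' ∧ i ∈ lastNonzero α l' := by
  classical
  have hne : (Finset.univ.filter fun l' => α i l' ≠ 0).Nonempty := ⟨l, by simpa using h⟩
  refine ⟨(Finset.univ.filter fun l' => α i l' ≠ 0).max' hne,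
    Finset.le_max' _ _ (by simpa using h), mem_lastNonzero.2 ⟨fun l' hl' => ?_, ?_⟩⟩
  · by_contra hc
    exact absurd (Finset.le_max' _ l' (by simpa using hc)) (not_le.2 hl')
  · simpa using Finset.max'_mem _ hne

lemma mem_lastNonzero_of_sub (h : i ∈ lastNonzero (α - β) l) :
    (i ∈ lastNonzero α l ∨ i ∈ lastNonzero β l) ∨ ∃ l', l < l' ∧ i ∈ lastNonzero α l' := by
  by_cases hα : ∃ l', l < l' ∧ α i l' ≠ 0
  · obtain ⟨l', hl', hne⟩ := hα
    obtain ⟨l'', hl'', hmem⟩ := exists_mem_lastNonzero hne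
    exact Or.inr ⟨l'', hl'.trans_le hl'', hmem⟩
  · push Not at hα
    rw [mem_lastNonzero] at h
    have hβ : ∀ l', l < l' → β i l' = 0 := fun l' hl' => by
      have h1 : α i l' - β i l' = 0 := h.1 l' hl'
      rw [hα l' hl', zero_sub, neg_eq_zero] at h1
      exact h1
    left
    rw [mem_lastNonzero, mem_lastNonzero]
    by_cases h0 : α i l = 0
    · refine Or.inr ⟨hβ, fun hb => h.2 ?_⟩
      rw [Pi.sub_apply, Pi.sub_apply, h0, hb, sub_zero]
    · exact Or.inl ⟨hα, h0⟩

lemma card_lastNonzero_sub_le (α β : Fin n → Fin m → k) (l : Fin m) :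
    (lastNonzero (α - β) l).card ≤ (lastNonzero α l).card + (lastNonzero β l).card +
      ∑ ν ∈ Finset.Ioi l, (lastNonzero α ν).card := by
  classical
  have hsub : lastNonzero (α - β) l ⊆ (lastNonzero α l ∪ lastNonzero β l) ∪
      (Finset.Ioi l).biUnion (lastNonzero α) := by
    intro i hi
    simpa [or_assoc] using mem_lastNonzero_of_sub hi
  refine (Finset.card_le_card hsub).trans ((Finset.card_union_le _ _).trans ?_)
  exact add_le_add (Finset.card_union_le _ _) Finset.card_biUnion_le

/-- `∑_l w_l |I_l(α)|` is a sum over positions of a weight depending only on the index of the last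
nonzero coordinate. -/
lemma sum_mul_card_lastNonzero (w : Fin m → ℕ) (α : Fin n → Fin m → k) :
    ∑ l, w l * (lastNonzero α l).card = ∑ i, ∑ l, if i ∈ lastNonzero α l then w l else 0 := by
  rw [Finset.sum_comm]
  refine Finset.sum_congr rfl fun l _ => ?_
  rw [← Finset.sum_filter, Finset.sum_const, smul_eq_mul, mul_comm]
  congr 2
  ext i
  simp

/-- The triangle inequality for the weight `∑_l (l + 1) |I_l(α)|`. -/
lemma sum_card_lastNonzero_sub_le (α β : Fin n → Fin m → k) :
    ∑ l : Fin m, ((l : ℕ) + 2) * (lastNonzero (α - β) l).card ≤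
      ∑ l : Fin m, ((l : ℕ) + 2) * (lastNonzero α l).card +
        ∑ l : Fin m, ((l : ℕ) + 2) * (lastNonzero β l).card := by
  rw [sum_mul_card_lastNonzero, sum_mul_card_lastNonzero, sum_mul_card_lastNonzero,
    ← Finset.sum_add_distrib]
  refine Finset.sum_le_sum fun i _ => ?_
  have hle : ∀ (γ : Fin n → Fin m → k) (l : Fin m), i ∈ lastNonzero γ l →
      (l : ℕ) + 2 ≤ ∑ l : Fin m, if i ∈ lastNonzero γ l then (l : ℕ) + 2 else 0 := by
    intro γ l hl
    calc (l : ℕ) + 2 = if i ∈ lastNonzero γ l then (l : ℕ) + 2 else 0 := by rw [if_pos hl]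
      _ ≤ _ := Finset.single_le_sum
        (f := fun l : Fin m => if i ∈ lastNonzero γ l then (l : ℕ) + 2 else 0)
        (fun _ _ => Nat.zero_le _) (Finset.mem_univ l)
  by_cases h : ∃ l, i ∈ lastNonzero (α - β) l
  · obtain ⟨l, hl⟩ := h
    rw [Finset.sum_eq_single l (fun l' _ hl' => if_neg fun h' =>
      hl' (eq_of_mem_lastNonzero h' hl)) (by simp), if_pos hl]
    rcases mem_lastNonzero_of_sub hl with (h | h) | ⟨l', hl', h⟩
    · have := hle α l h; omega
    · have := hle β l h; omega
    · have := hle α l' h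
      have : (l : ℕ) < l' := hl'
      omega
  · push Not at h
    simp [h]

end LastNonzero

/-! ### Local coefficients and orders of vanishing -/

namespace Place

variable {Q : Place k F} {t : F}

lemma isLocalExpansion_localCoeff (hQ : Q.IsRational) (ht : Q.IsLocalParameter t) {f : F}
    (hf : Q.val f ≤ 1) : Q.IsLocalExpansion t f (Q.localCoeff t f) := by
  have h := (existsUnique_isLocalExpansion hQ ht f hf).exists
  rw [localCoeff, dif_pos h]
  exact Classical.choose_spec h

lemma localCoeff_sub (hQ : Q.IsRational) (ht : Q.IsLocalParameter t) {f g : F}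
    (hf : Q.val f ≤ 1) (hg : Q.val g ≤ 1) :
    Q.localCoeff t (f - g) = Q.localCoeff t f - Q.localCoeff t g := by
  have hfg : Q.val (f - g) ≤ 1 := Q.val.map_sub_le hf hg
  refine (existsUnique_isLocalExpansion hQ ht _ hfg).unique
    (isLocalExpansion_localCoeff hQ ht hfg) fun N => ?_
  have h := Q.val.map_sub_le (isLocalExpansion_localCoeff hQ ht hf N)
    (isLocalExpansion_localCoeff hQ ht hg N)
  convert h using 2
  simp only [Pi.sub_apply, map_sub, sub_mul, Finset.sum_sub_distrib]
  ring

lemma le_ord_iff_localCoeff_eq_zero (hQ : Q.IsRational) (ht : Q.IsLocalParameter t) {f : F}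
    (hf : Q.val f ≤ 1) (hf0 : f ≠ 0) (j : ℕ) :
    (j : ℤ) ≤ Q.ord f ↔ ∀ l < j, Q.localCoeff t f l = 0 := by
  have hexp := isLocalExpansion_localCoeff hQ ht hf
  induction j with
  | zero =>
    have := (Q.val_le_exp_iff hf0 0).1 (by simpa using hf)
    simpa using this
  | succ j ih =>
    refine Iff.trans ?_ ((and_congr_left' ih).trans Nat.forall_lt_succ_right.symm)
    have hstep : (j : ℤ) ≤ Q.ord f →
        Q.val (f - algebraMap k F (Q.localCoeff t f j) * t ^ j) ≤
          WithZero.exp (-((j + 1 : ℕ) : ℤ)) := by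
      intro h
      have h1 := hexp (j + 1)
      rwa [Finset.sum_range_succ, Finset.sum_eq_zero (fun l hl => by
        rw [ih.1 h l (Finset.mem_range.1 hl), map_zero, zero_mul]), zero_add] at h1
    constructor
    · intro h
      have hj : (j : ℤ) ≤ Q.ord f := by push_cast at h; omega
      refine ⟨hj, ?_⟩
      by_contra hne
      have h2 : Q.val f ≤ WithZero.exp (-((j + 1 : ℕ) : ℤ)) := by
        rw [Q.val_le_exp_iff hf0, neg_neg]; exact h
      have h3 := Q.val.map_sub_le h2 (hstep hj)
      rw [sub_sub_cancel, map_mul, map_pow, Q.val_algebraMap _ hne, one_mul,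
        val_of_isLocalParameter ht, ← WithZero.exp_nsmul, WithZero.exp_le_exp] at h3
      simp at h3
    · rintro ⟨hj, h0⟩
      have h1 := hstep hj
      rw [h0, map_zero, zero_mul, sub_zero, Q.val_le_exp_iff hf0, neg_neg] at h1
      exact h1

lemma ord_eq_iff_localCoeff (hQ : Q.IsRational) (ht : Q.IsLocalParameter t) {f : F}
    (hf : Q.val f ≤ 1) (hf0 : f ≠ 0) (j : ℕ) :
    Q.ord f = j ↔ (∀ l < j, Q.localCoeff t f l = 0) ∧ Q.localCoeff t f j ≠ 0 := by
  have h1 := le_ord_iff_localCoeff_eq_zero hQ ht hf hf0 j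
  have h2 := le_ord_iff_localCoeff_eq_zero hQ ht hf hf0 (j + 1)
  rw [Nat.forall_lt_succ_right, ← h1] at h2
  push_cast at h2
  rw [← h1]
  constructor
  · intro h
    refine ⟨h.ge, fun h0 => ?_⟩
    have := h2.2 ⟨h.ge, h0⟩
    omega
  · rintro ⟨hj, h0⟩
    by_contra hne
    exact h0 (h2.1 (by omega)).2

end Place

/-! ### Zero divisors of differences and the distance of the code -/

section Code

variable {P : Fin n → Place k F} {t : Fin n → F}

/-- `|I_l(Φ(f))| = j_l((f)_0)`: the last nonzero coordinate of the `i`-th block of `Φ(f)` is the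
coefficient of the lowest power of `t_i` occurring in `f`. -/
lemma card_lastNonzero_lowCoeffs (hPr : ∀ i, (P i).IsRational)
    (ht : ∀ i, (P i).IsLocalParameter (t i)) {f : F} (hf : ∀ i, (P i).val f ≤ 1) (hf0 : f ≠ 0)
    (l : Fin m) :
    (lastNonzero (lowCoeffs P t m f) l).card =
      jCount P m (zeroOrders (k := k) f) ((l : ℕ) + 1) := by
  rw [jCount]
  congr 1
  ext i
  have hord : 0 ≤ (P i).ord f := by
    have := ((P i).val_le_exp_iff hf0 0).1 (by simpa using hf i)
    simpa using this
  have hl := l.2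
  have h1 : zeroOrders f (P i) = (m : ℤ) - (((l : ℕ) + 1 : ℕ) : ℤ) ↔
      (P i).ord f = ((m - 1 - (l : ℕ) : ℕ) : ℤ) := by
    rw [zeroOrders]
    omega
  rw [mem_lastNonzero, Finset.mem_filter, h1,
    Place.ord_eq_iff_localCoeff (hPr i) (ht i) (hf i) hf0]
  simp only [Finset.mem_univ, true_and, lowCoeffs]
  refine and_congr_left fun _ => ⟨fun h p hp => ?_, fun h l' hl' => h _ ?_⟩
  · have h2 := h ⟨m - 1 - p, by omega⟩ (by rw [Fin.lt_def]; simp only; omega)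
    have h3 : m - 1 - (m - 1 - p) = p := by omega
    rwa [show ((⟨m - 1 - p, by omega⟩ : Fin m) : ℕ) = m - 1 - p from rfl, h3] at h2
  · have h2 := l'.2
    have h3 : (l : ℕ) < l' := hl'
    omega

/-- `j_0(E)` is at most the Hamming weight of `ψ(f)`, for `E = (f)_0`. -/
lemma jCount_zero_le [DecidableEq k] (hPr : ∀ i, (P i).IsRational)
    (ht : ∀ i, (P i).IsLocalParameter (t i)) {f : F} (hf : ∀ i, (P i).val f ≤ 1) (hf0 : f ≠ 0) :
    jCount P m (zeroOrders (k := k) f) 0 ≤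
      (Finset.univ.filter fun i => (P i).localCoeff (t i) f m ≠ 0).card := by
  rw [jCount]
  refine Finset.card_le_card fun i hi => ?_
  have hord : 0 ≤ (P i).ord f := by
    have := ((P i).val_le_exp_iff hf0 0).1 (by simpa using hf i)
    simpa using this
  have hi' := (Finset.mem_filter.1 hi).2
  rw [zeroOrders] at hi'
  have h1 : (P i).ord f = (m : ℤ) := by push_cast at hi'; omega
  rw [Place.ord_eq_iff_localCoeff (hPr i) (ht i) (hf i) hf0] at h1
  exact Finset.mem_filter.2 ⟨Finset.mem_univ _, h1.2⟩

/-- `deg Ē + J_m(E) + j_0(E) ≥ (m + 1) n`: each `P_i` contributes at least `m + 1`. -/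
lemma mul_le_degree_restrictDivisor_add (hPr : ∀ i, (P i).IsRational) (E : Place k F → ℤ)
    (hE : ∀ i, 0 ≤ E (P i)) :
    ((m : ℤ) + 1) * n ≤ Divisor.degree (restrictDivisor P m E) + jSum P m E + jCount P m E 0 := by
  have hdeg : Divisor.degree (restrictDivisor P m E) = ∑ i, min ((m : ℤ) + 1) (E (P i)) := by
    rw [restrictDivisor, map_sum]
    refine Finset.sum_congr rfl fun i _ => ?_
    rw [Divisor.degree_single, show (P i).degree = 1 from hPr i, Nat.cast_one, mul_one]
  have hj : ∀ l : ℕ, (jCount P m E l : ℤ) = ∑ i, if E (P i) = (m : ℤ) - l then 1 else 0 := by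
    intro l
    rw [jCount, Finset.card_filter]
    push_cast
    rfl
  have hJ : (jSum P m E : ℤ) = ∑ i, ∑ l : Fin m,
      if E (P i) = (m : ℤ) - ((l : ℕ) + 1 : ℕ) then ((l : ℕ) + 2 : ℤ) else 0 := by
    rw [jSum, Finset.sum_comm]
    push_cast
    refine Finset.sum_congr rfl fun l _ => ?_
    rw [hj, Finset.mul_sum]
    push_cast
    refine Finset.sum_congr rfl fun i _ => ?_
    split_ifs <;> simp
  rw [hdeg, hJ, hj, ← Finset.sum_add_distrib, ← Finset.sum_add_distrib]
  have hconst : ((m : ℤ) + 1) * n = ∑ _i : Fin n, ((m : ℤ) + 1) := by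
    rw [Finset.sum_const, Finset.card_univ, Fintype.card_fin, nsmul_eq_mul, mul_comm]
  rw [hconst]
  refine Finset.sum_le_sum fun i _ => ?_
  have h0 := hE i
  have hnn : ∀ l ∈ (Finset.univ : Finset (Fin m)),
      (0 : ℤ) ≤ if E (P i) = (m : ℤ) - ((l : ℕ) + 1 : ℕ) then ((l : ℕ) + 2 : ℤ) else 0 := by
    intro l _
    split_ifs <;> positivity
  have hS := Finset.sum_nonneg hnn
  rcases lt_trichotomy (E (P i)) m with h | h | h
  · have hl : m - 1 - (E (P i)).toNat < m := by omega
    have h1 := Finset.single_le_sum hnn (Finset.mem_univ (⟨_, hl⟩ : Fin m))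
    rw [if_pos (by simp only; omega)] at h1
    simp only at h1
    have h2 : (0 : ℤ) ≤ if E (P i) = (m : ℤ) - (0 : ℕ) then 1 else 0 := by
      split_ifs <;> simp
    omega
  · have h2 : (1 : ℤ) = if E (P i) = (m : ℤ) - (0 : ℕ) then 1 else 0 := by
      rw [if_pos (by rw [h]; simp)]
    omega
  · have h2 : (0 : ℤ) ≤ if E (P i) = (m : ℤ) - (0 : ℕ) then 1 else 0 := by
      split_ifs <;> simp
    omega

/-- Two distinct elements of `N_c` have images under `ψ` that differ in at least
`(m + 1) n + 1 - s - 2 ∑ (l + 1) X_l` positions: the zero divisor of their difference satisfies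
the bounds on `j_l` and `J_m`, so its restriction to the `P_i` has degree at most `s - 1`. -/
theorem IsDistinguished.le_hammingDist [DecidableEq k] (hPr : ∀ i, (P i).IsRational)
    (ht : ∀ i, (P i).IsLocalParameter (t i)) {r s : ℕ} {x : Fin m → ℝ} {G : Divisor k F}
    (hG : IsDistinguished P r s (fun l => ⌊x l * n⌋₊) G) {c : Fin n → Fin m → k} {f g : F}
    (hf : f ∈ fiberSet P t x G c) (hg : g ∈ fiberSet P t x G c) (hne : f ≠ g) :
    ((m : ℤ) + 1) * n + 1 - s - 2 * ∑ l : Fin m, ((l : ℤ) + 2) * (⌊x l * n⌋₊ : ℤ) ≤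
      hammingDist (topCoeffs P t m f) (topCoeffs P t m g) := by
  obtain ⟨-, hGP, hdist⟩ := hG
  have hint : ∀ z ∈ riemannRochSpace G, ∀ i, (P i).val z ≤ 1 := fun z hz i => by
    have := hz (P i)
    rwa [hGP, WithZero.exp_zero] at this
  have hfi := hint f hf.1
  have hgi := hint g hg.1
  have hmem : f - g ∈ riemannRochSpace G := sub_mem hf.1 hg.1
  have h0 : f - g ≠ 0 := sub_ne_zero.2 hne
  have hcoeff : ∀ i, (P i).localCoeff (t i) (f - g) =
      (P i).localCoeff (t i) f - (P i).localCoeff (t i) g := fun i =>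
    Place.localCoeff_sub (hPr i) (ht i) (hfi i) (hgi i)
  have hlow : lowCoeffs P t m (f - g) =
      (lowCoeffs P t m f - c) - (lowCoeffs P t m g - c) := by
    rw [sub_sub_sub_cancel_right]
    funext i l
    simp only [lowCoeffs, hcoeff, Pi.sub_apply]
  have hj : ∀ l : Fin m, jCount P m (zeroOrders (k := k) (f - g)) ((l : ℕ) + 1) =
      (lastNonzero ((lowCoeffs P t m f - c) - (lowCoeffs P t m g - c)) l).card := fun l => by
    rw [← card_lastNonzero_lowCoeffs hPr ht (hint _ hmem) h0, hlow]
  have hα : ∀ l, (lastNonzero (lowCoeffs P t m f - c) l).card ≤ ⌊x l * n⌋₊ := hf.2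
  have hβ : ∀ l, (lastNonzero (lowCoeffs P t m g - c) l).card ≤ ⌊x l * n⌋₊ := hg.2
  have hcount : CountBound P (fun l => ⌊x l * n⌋₊) (zeroOrders (k := k) (f - g)) := by
    intro l
    rw [hj]
    refine (card_lastNonzero_sub_le _ _ l).trans ?_
    rw [two_mul]
    exact add_le_add (add_le_add (hα l) (hβ l)) (Finset.sum_le_sum fun ν _ => hα ν)
  have hsum : SumBound P (fun l => ⌊x l * n⌋₊) (zeroOrders (k := k) (f - g)) := by
    rw [SumBound, jSum]
    simp only [hj]
    refine (sum_card_lastNonzero_sub_le _ _).trans ?_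
    rw [two_mul]
    exact add_le_add (Finset.sum_le_sum fun l _ => Nat.mul_le_mul_left _ (hα l))
      (Finset.sum_le_sum fun l _ => Nat.mul_le_mul_left _ (hβ l))
  have hdeg := hdist _ hmem h0 hcount hsum
  have hlower := mul_le_degree_restrictDivisor_add (m := m) hPr (zeroOrders (k := k) (f - g))
    (fun i => le_max_right _ _)
  have hham : jCount P m (zeroOrders (k := k) (f - g)) 0 ≤
      hammingDist (topCoeffs P t m f) (topCoeffs P t m g) := by
    refine (jCount_zero_le hPr ht (hint _ hmem) h0).trans (le_of_eq ?_)
    rw [hammingDist]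
    refine congrArg Finset.card (Finset.filter_congr fun i _ => ?_)
    rw [hcoeff, Pi.sub_apply, ne_eq, sub_eq_zero, topCoeffs, topCoeffs]
  have hsum' : (jSum P m (zeroOrders (k := k) (f - g)) : ℤ) ≤
      2 * ∑ l : Fin m, ((l : ℤ) + 2) * (⌊x l * n⌋₊ : ℤ) := by
    have h : jSum P m (zeroOrders (k := k) (f - g)) ≤
        2 * ∑ l : Fin m, ((l : ℕ) + 2) * ⌊x l * n⌋₊ := hsum
    exact_mod_cast h
  have hham' : (jCount P m (zeroOrders (k := k) (f - g)) 0 : ℤ) ≤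
      hammingDist (topCoeffs P t m f) (topCoeffs P t m g) := by exact_mod_cast hham
  linarith

end Code

end GlobalFF

theorem theorem2p9 {k : Type*} {F : Type*} [Field k] [Finite k] [Field F] [Algebra k F]
    (hF : GlobalFF.IsFunctionFieldWithFullConstants k F)
    -- `P_1, …, P_n` are all the rational places of `F`, with local parameters `t_1, …, t_n`
    {n : ℕ} (hn : 1 ≤ n) (P : Fin n → GlobalFF.Place k F) (hP : Function.Injective P)
    (hPr : ∀ Q : GlobalFF.Place k F, Q.IsRational ↔ Q ∈ Set.range P)
    (t : Fin n → F) (ht : ∀ i, (P i).IsLocalParameter (t i))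
    {m : ℕ} (hm : 1 ≤ m) {r s : ℕ} (hsr : s ≤ r)
    -- `x l` for `l : Fin m` stands for `x_{l+1}`
    (x : Fin m → ℝ) (hx : ∀ l, 0 ≤ x l) (hx1 : ∑ l, x l ≤ 1)
    (hV : (GlobalFF.divisorSet P r s (fun l => ⌊x l * n⌋₊)).encard <
      (GlobalFF.classNumber k F : ℕ∞)) :
    (∃ G : GlobalFF.Divisor k F, GlobalFF.IsDistinguished P r s (fun l => ⌊x l * n⌋₊) G) ∧
    ∀ G : GlobalFF.Divisor k F, GlobalFF.IsDistinguished P r s (fun l => ⌊x l * n⌋₊) G →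
      Nat.card k ^ (m * n) < Nat.card (GlobalFF.riemannRochSpace G) *
        (GlobalFF.ballSet x (0 : Fin n → Fin m → k)).ncard →
      -- a vector `c` for which `N_c` is as large as required exists, and
      (∃ c : Fin n → Fin m → k,
        ((Nat.card (GlobalFF.riemannRochSpace G) : ℝ) *
            ((GlobalFF.ballSet x (0 : Fin n → Fin m → k)).ncard : ℝ)) /
          (Nat.card k : ℝ) ^ (m * n) ≤ ((GlobalFF.fiberSet P t x G c).ncard : ℝ)) ∧
      -- if `(m+1) n ≥ s + 2 ∑ (l+1) ⌊x_l n⌋`, then for every such `c` the code `C = ψ(N_c)`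
      -- satisfies both bounds
      (s + 2 * ∑ l : Fin m, ((l : ℕ) + 2) * ⌊x l * n⌋₊ ≤ (m + 1) * n →
      ∀ c : Fin n → Fin m → k,
        ((Nat.card (GlobalFF.riemannRochSpace G) : ℝ) *
            ((GlobalFF.ballSet x (0 : Fin n → Fin m → k)).ncard : ℝ)) /
          (Nat.card k : ℝ) ^ (m * n) ≤ ((GlobalFF.fiberSet P t x G c).ncard : ℝ) →
        ⌈((Nat.card (GlobalFF.riemannRochSpace G) : ℝ) *
            ((GlobalFF.ballSet x (0 : Fin n → Fin m → k)).ncard : ℝ)) /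
          (Nat.card k : ℝ) ^ (m * n)⌉₊ ≤
            (GlobalFF.topCoeffs P t m '' GlobalFF.fiberSet P t x G c).ncard ∧
        ((m : ℤ) + 1) * n + 1 - s - 2 * ∑ l : Fin m, ((l : ℤ) + 2) * (⌊x l * n⌋₊ : ℤ) ≤
          (GlobalFF.minDistance (GlobalFF.topCoeffs P t m '' GlobalFF.fiberSet P t x G c) : ℤ)) := by
  classical
  have hrat : ∀ i, (P i).IsRational := fun i => (hPr _).2 ⟨i, rfl⟩
  refine ⟨hF.exists_isDistinguished hn P hrat _ hV, fun G hG hcard => ?_⟩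
  have hpos : 0 < Nat.card (GlobalFF.riemannRochSpace G) :=
    Nat.pos_of_ne_zero fun h => by simp [h] at hcard
  have hfin : Finite (GlobalFF.riemannRochSpace G) := Nat.finite_of_card_ne_zero hpos.ne'
  have hfiber : ∀ c, (GlobalFF.fiberSet P t x G c).Finite := fun c =>
    (Set.toFinite (GlobalFF.riemannRochSpace G : Set F)).subset fun f hf => hf.1
  constructor
  · obtain ⟨c, hc⟩ := GlobalFF.exists_translate_card_ge
      (fun f : GlobalFF.riemannRochSpace G => GlobalFF.lowCoeffs P t m (f : F))
      (GlobalFF.ballSet x (0 : Fin n → Fin m → k))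
    refine ⟨c, ?_⟩
    have hV : (Nat.card (Fin n → Fin m → k) : ℝ) = (Nat.card k : ℝ) ^ (m * n) := by
      rw [Nat.card_fun, Nat.card_fun, Nat.card_fin, Nat.card_fin, ← pow_mul]
      push_cast
      rfl
    have himage : GlobalFF.fiberSet P t x G c = Subtype.val ''
        {f : GlobalFF.riemannRochSpace G | GlobalFF.lowCoeffs P t m (f : F) - c ∈
          GlobalFF.ballSet x (0 : Fin n → Fin m → k)} := by
      ext f
      simp [GlobalFF.fiberSet, GlobalFF.ballSet, and_comm]
    rw [himage, Set.ncard_image_of_injective _ Subtype.val_injective, ← hV]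
    exact hc
  · intro hle c hc
    have hle' : (s : ℤ) + 2 * ∑ l : Fin m, ((l : ℤ) + 2) * (⌊x l * n⌋₊ : ℤ) ≤
        ((m : ℤ) + 1) * n := by exact_mod_cast hle
    have hinj : Set.InjOn (GlobalFF.topCoeffs P t m) (GlobalFF.fiberSet P t x G c) := by
      intro f hf g hg hfg
      by_contra hne
      have h := hG.le_hammingDist hrat ht hf hg hne
      rw [hfg, hammingDist_self] at h
      push_cast at h
      linarith
    refine ⟨?_, ?_⟩
    · rw [hinj.ncard_image]
      exact Nat.ceil_le.2 hc
    · -- `|N_c| > 1`, so the minimum is attained by two distinct codewords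
      have hq : (0 : ℝ) < (Nat.card k : ℝ) ^ (m * n) := by
        have : 0 < Nat.card k := Nat.card_pos
        positivity
      have h1 : (1 : ℝ) < (GlobalFF.fiberSet P t x G c).ncard := by
        refine lt_of_lt_of_le ?_ hc
        rw [one_lt_div hq]
        exact_mod_cast hcard
      obtain ⟨f, hf, g, hg, hne⟩ := (Set.one_lt_ncard (hfiber c)).1 (by exact_mod_cast h1)
      obtain ⟨_, ⟨f', hf', rfl⟩, _, ⟨g', hg', rfl⟩, hne', hd⟩ := Nat.sInf_mem
        (s := {d | ∃ u ∈ GlobalFF.topCoeffs P t m '' GlobalFF.fiberSet P t x G c,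
          ∃ w ∈ GlobalFF.topCoeffs P t m '' GlobalFF.fiberSet P t x G c,
            u ≠ w ∧ hammingDist u w = d})
        ⟨_, _, ⟨f, hf, rfl⟩, _, ⟨g, hg, rfl⟩, fun h => hne (hinj hf hg h), rfl⟩
      have h2 := hG.le_hammingDist hrat ht hf' hg' (fun h => hne' (by rw [h]))
      rw [hd] at h2
      exact h2
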